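/- **Definitions.** Let $(E;\oplus,0,1)$ be an effect algebra: $\oplus$ is a partial commutative and associative operation, for every $a$ there is a unique $a'$ with $a\oplus a'=1$, and if $a\oplus 1$ is defined then $a=0$. Write $a\perp b$ if $a\oplus b$ is defined, and $a\le b$ if $a\oplus c=b$ for some $c$, in which case $b\ominus a:=c$. $E$ is *archimedean* if $a=0$ whenever $na=a\oplus\dots\oplus a$ is defined for all $n$. Elements $a,b$ are *Mackey compatible*, $a\leftrightarrow b$, if $a=a_1\oplus c$, $b=b_1\oplus c$ with $a_1\oplus b_1\oplus c$ defined. $E$ is *convex* if elements $\lambda a$ ($\lambda\in[0,1]$, $a\in E$) are given with $\mu(\lambda a)=(\lambda\mu)a$, $(\lambda+\mu)a=\lambda a\oplus\mu a$ if $\lambda+\mu\le1$, $\lambda(a\oplus b)=\lambda a\oplus\lambda b$ if $a\perp b$, and $1a=a$ (the sums on the right being defined). A convex $E$ is *strongly archimedean* if $a\le b\oplus\frac1n c$ for all $n\ge1$ (the sums being defined) implies $a\le b$. A *compression* on $E$ is an additive map $J:E\to E$ with $J(a)=a$ for $a\le J(1)$ and $J(a)=0\iff a\le J(1)'$. A *compression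 base* is a family $(J_p)_{p\in P}$ of compressions indexed by a sub-effect algebra $P\subseteq E$ with $J_p(1)=p$, such that if $p,q\in P$ are Mackey compatible then $J_p\circ J_q=J_r$ for some $r\in P$. Put $C(p)=\{a: a=J_p(a)\oplus J_{p'}(a)\}$; for $A\subseteq E$ put $PC(A)=\{p\in P: A\subseteq C(p)\}$ and $P(A)=PC(PC(A)\cup A)$, and write $P(a)=P(\{a\})$, $P(a,b)=P(\{a,b\})$. Write $aCb$ if $p\leftrightarrow q$ for all $p\in P(a)$, $q\in P(b)$. A *projection cover* of $a$ is an element $a^{\rm o}\in P$ with $a\le q\iff a^{\rm o}\le q$ for all $q\in P$. $E$ (with its compression base) is *spectral* if every $a\in E$ has a projection cover; for each $a$ there is a Boolean subalgebra $B(a)\subseteq P$ such that for all $p\in P$, $a\in C(p)\iff B(a)\subseteq C(p)$; and for all $a,b$ with $aCb$ the set $P_\le(a,b)=\{p\in P(a,b): J_p(a)\le J_p(b),\ J_{p'}(b)\le J_{p'}(a)\}$ is non-empty. For $aCb$ put $(b-a)_+=J_p(b)\ominus J_p(a)$, where $p\in P_\le(a,b)$. For $a\in E$ and finite binary strings $w$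 define $c_\varepsilon=a$, $u_\varepsilon=a^{\rm o}$, and $$u_{w0}=((c_w-c_w')_+{}^{\rm o})'\wedge u_w,\quad u_{w1}=u_w\wedge u_{w0}',\quad c_{w0}=u_{w0}\ominus[(c_w'-c_w)_+\wedge u_w],\quad c_{w1}=(c_w-c_w')_+\wedge u_w .$$ For a string $w$ of length $n$ let $k(w)$ be the integer with binary expansion $w$. The *binary spectral resolution* of $a$ is given by $p_0=(a^{\rm o})'$, $p_1=1$ and, for $w$ of length $n\geq 0$, $p_{(2k(w)+1)/2^{n+1}}=(a^{\rm o})'\oplus\bigoplus_{\tilde w\le w0}u_{\tilde w}$, the sum being over strings of length $n+1$ in lexicographic order. The *rational spectral resolution* $\{p_{a,\lambda}\}_{\lambda\in\mathbb Q}$ is given by $p_{a,\lambda}=\bigwedge\{p_\mu:\mu\in(\lambda,1]\text{ dyadic}\}$ for $0\le\lambda<1$, $p_{a,\lambda}=0$ for $\lambda<0$, $p_{a,\lambda}=1$ for $\lambda\ge1$. Let $(V,V^+)$ be an ordered real vector space with order unit $u$. $(V,V^+,u)$ is an *order unit space* if moreover $nx\le y$ for all $n\in\mathbb N$ implies $x\le0$;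 its norm is $\|x\|=\inf\{r\ge0:-ru\le x\le ru\}$. A *compression base* on $(V,V^+,u)$ is a family $(J_p)_{p\in P}$ of positive linear maps on $V$ whose restrictions form a compression base of the effect algebra $V[0,u]$. With $p'=u-p$, the sets $C(p)$, $PC(g)$ and $P(g)$ are defined for $g\in V$ as above. $(V,V^+,u)$ with this compression base is a *spectral order unit space* if it is an order unit space; for each $g\in V$ there is $p\in P(g)$ with $J_{p'}(g)\le0\le J_p(g)$; and for each $g\in V$ there is $g^*\in P$ such that for all $p\in P$, $p\le g^*\iff g\in C(p)$ and $J_p(g)=0$. An *orthogonal decomposition* of $g$ is $g=g_+-g_-$ with $g_\pm\ge0$ and $J_p(g)=g_+$, $J_{p'}(g)=-g_-$ for some $p\in P$. The *spectral resolution* of $g$ in $V$ is $\lambda\mapsto((g-\lambda u)_+)^*$, $\lambda\in\mathbb R$. **Theorem.** Let $E$ be a convex archimedean effect algebra with a compression base $(J_p)_{p\in P}$ with respect to which $E$ is spectral, and let the universal group of $E$ be given by the ordered real vector space $(V,V^+)$ with order unit $u$, so that $E\simeq V[0,u]$ by an affine isomorphism, by which we identify $E$ with $V[0,u]$. Then: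 1. $E$ is strongly archimedean, and $(V,V^+,u)$ is an order unit space. 2. Each $J_p$, $p\in P$, extends uniquely to an additive map on $V$; these extensions are linear and form a compression base on $(V,V^+,u)$, with which $(V,V^+,u)$ is a spectral order unit space. 3. Every $a\in E$ has a unique rational spectral resolution $\{p_{a,\lambda}\}_{\lambda\in\mathbb Q}$. For every $\lambda\in\mathbb R$ the infimum $p_{a,\lambda}:=\bigwedge_{\mu>\lambda,\ \mu\in\mathbb Q}p_{a,\mu}$ exists in $E$ and belongs to $P$, it agrees with the given $p_{a,\lambda}$ if $\lambda\in\mathbb Q$, and $\{p_{a,\lambda}\}_{\lambda\in\mathbb R}$ coincides with the spectral resolution of $a$ in $(V,V^+,u)$; that is, $a-\lambda u$ has an orthogonal decomposition and, for every such decomposition, $((a-\lambda u)_+)^*=p_{a,\lambda}$. 4. For every $a\in E$, $a=\int_0^1\lambda\,dp_{a,\lambda}$ as a Riemann–Stieltjes integral: the sums $\sum_j\xi_j(p_{a,\lambda_{j+1}}-p_{a,\lambda_j})$ over partitions $0=\lambda_0\le\dots\le\lambda_N=1$ with $\xi_j\in[\lambda_j,\lambda_{j+1}]$ converge to $a$ in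 the order unit norm as the mesh tends to $0$. -/

import Mathlib

/-! ## Effect algebras -/

/-- An effect algebra. `perp a b` says that the partial sum of `a` and `b` is defined, and then
`oplus a b` is that sum; the value of `oplus a b` is never used unless `perp a b` holds. -/
class EffectAlgebra (E : Type*) extends Zero E, One E where
  perp : E → E → Prop
  oplus : E → E → E
  comm : ∀ a b, perp a b → perp b a ∧ oplus a b = oplus b a
  assoc : ∀ a b c, perp a b → perp (oplus a b) c →
    perp b c ∧ perp a (oplus b c) ∧ oplus (oplus a b) c = oplus a (oplus b c)
  exists_unique_orth : ∀ a, ∃! b, perp a b ∧ oplus a b = 1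
  eq_zero_of_perp_one : ∀ a, perp a 1 → a = 0

namespace EffectAlgebra

variable {E : Type*} [EffectAlgebra E]

/-- The orthosupplement of `a`. -/
noncomputable def orth (a : E) : E := Classical.choose (exists_unique_orth a)

theorem perp_orth (a : E) : perp a (orth a) :=
  (Classical.choose_spec (exists_unique_orth a)).1.1

theorem oplus_orth (a : E) : oplus a (orth a) = 1 :=
  (Classical.choose_spec (exists_unique_orth a)).1.2

theorem eq_orth {a b : E} (h : perp a b) (h1 : oplus a b = 1) : b = orth a :=
  (Classical.choose_spec (exists_unique_orth a)).2 b ⟨h, h1⟩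

theorem orth_orth (a : E) : orth (orth a) = a := by
  have h := comm a (orth a) (perp_orth a)
  exact (eq_orth h.1 (h.2 ▸ oplus_orth a)).symm

theorem perp_zero_oplus_zero (a : E) : perp a 0 ∧ oplus a 0 = a := by
  have h1 : orth (1 : E) = 0 := eq_zero_of_perp_one _ (comm _ _ (perp_orth (1 : E))).1
  have hp : perp (1 : E) 0 := h1 ▸ perp_orth (1 : E)
  have hs : oplus (1 : E) 0 = 1 := h1 ▸ oplus_orth (1 : E)
  have key : ∀ b : E, perp (orth b) 0 ∧ oplus (orth b) 0 = orth b := by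
    intro b
    have h := assoc b (orth b) 0 (perp_orth b) (by rw [oplus_orth]; exact hp)
    refine ⟨h.1, eq_orth h.2.1 ?_⟩
    rw [← h.2.2, oplus_orth, hs]
  have := key (orth a)
  rwa [orth_orth] at this

theorem oplus_left_cancel {a b c : E} (hb : perp a b) (hc : perp a c)
    (h : oplus a b = oplus a c) : b = c := by
  have key : ∀ x : E, perp a x → oplus a x = oplus a b → x = orth (oplus a (orth (oplus a b))) := by
    intro x hx hxb
    have h1 := comm a x hx
    have h2 : perp (oplus x a) (orth (oplus a b)) := by
      rw [← h1.2, hxb]; exact perp_orth _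
    have h3 := assoc x a _ h1.1 h2
    have h4 := comm _ _ h3.2.1
    refine eq_orth h4.1 ?_
    rw [← h4.2, ← h3.2.2, ← h1.2, hxb, oplus_orth]
  rw [key b hb rfl, ← key c hc h.symm]

theorem eq_zero_of_oplus_eq_zero {a b : E} (hp : perp a b) (h : oplus a b = 0) : b = 0 := by
  have h1 : perp (0 : E) 1 := (comm _ _ (perp_zero_oplus_zero (1 : E)).1).1
  exact eq_zero_of_perp_one b (assoc a b 1 hp (by rw [h]; exact h1)).1

/-- The order of an effect algebra: `a ≤ b` if `a ⊕ c = b` for some `c`. -/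
instance : PartialOrder E where
  le a b := ∃ c, perp a c ∧ oplus a c = b
  le_refl a := ⟨0, perp_zero_oplus_zero a⟩
  le_trans a b c := by
    rintro ⟨x, hx, rfl⟩ ⟨y, hy, rfl⟩
    have h := assoc a x y hx hy
    exact ⟨oplus x y, h.2.1, h.2.2.symm⟩
  le_antisymm a b := by
    rintro ⟨x, hx, rfl⟩ ⟨y, hy, h1⟩
    have h := assoc a x y hx hy
    have h2 : oplus x y = 0 := oplus_left_cancel h.2.1 (perp_zero_oplus_zero a).1
      (by rw [← h.2.2, h1, (perp_zero_oplus_zero a).2])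
    have hy0 := eq_zero_of_oplus_eq_zero h.1 h2
    rw [hy0, (perp_zero_oplus_zero _).2] at h1
    exact h1.symm

/-- `OSumsTo x f m s`: the sum `x ⊕ f 0 ⊕ ⋯ ⊕ f (m - 1)` is defined and equal to `s`. -/
def OSumsTo (x : E) (f : ℕ → E) : ℕ → E → Prop
  | 0, s => s = x
  | m + 1, s => ∃ t, OSumsTo x f m t ∧ perp t (f m) ∧ oplus t (f m) = s

variable (E) in
/-- If `n a` is defined for all `n`, then `a = 0`. -/
def IsArchimedean : Prop :=
  ∀ a : E, (∀ n : ℕ, ∃ s, OSumsTo 0 (fun _ => a) n s) → a = 0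

/-- Mackey compatibility. -/
def MackeyCompat (a b : E) : Prop :=
  ∃ a₁ b₁ c : E, perp a₁ b₁ ∧ perp (oplus a₁ b₁) c ∧ a = oplus a₁ c ∧ b = oplus b₁ c

/-- Sub-effect algebras. -/
structure IsSubEffectAlgebra (P : Set E) : Prop where
  one_mem : (1 : E) ∈ P
  orth_mem : ∀ p ∈ P, orth p ∈ P
  oplus_mem : ∀ p ∈ P, ∀ q ∈ P, perp p q → oplus p q ∈ P

/-- `m` is the meet of `a` and `b`. -/
def IsMeet (a b m : E) : Prop := IsGLB {a, b} m

/-- Additive maps that are the identity below the image of `1`. -/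
structure IsRetraction (J : E → E) : Prop where
  additive : ∀ a b, perp a b → perp (J a) (J b) ∧ J (oplus a b) = oplus (J a) (J b)
  apply_of_le : ∀ a, a ≤ J 1 → J a = a

structure IsCompression (J : E → E) : Prop extends IsRetraction J where
  apply_eq_zero_iff : ∀ a, J a = 0 ↔ a ≤ orth (J 1)

end EffectAlgebra

open EffectAlgebra

/-- A compression base `(J p)_{p ∈ P}`. Only the maps `J p` with `p ∈ P` are meaningful. -/
structure CompressionBase (E : Type*) [EffectAlgebra E] where
  P : Set E
  J : E → E → E
  isSub : IsSubEffectAlgebra P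
  isCompression : ∀ p ∈ P, IsCompression (J p)
  focus : ∀ p ∈ P, J p 1 = p
  comp : ∀ p ∈ P, ∀ q ∈ P, MackeyCompat p q → ∃ r ∈ P, ∀ a, J p (J q a) = J r a

namespace CompressionBase

variable {E : Type*} [EffectAlgebra E] (B : CompressionBase E)

/-- The commutant `C(p)` of a projection. -/
def C (p : E) : Set E :=
  {a | perp (B.J p a) (B.J (orth p) a) ∧ oplus (B.J p a) (B.J (orth p) a) = a}

/-- The set `PC(A)` of the projections with which every element of `A` commutes. -/
def PC (A : Set E) : Set E := {p | p ∈ B.P ∧ ∀ a ∈ A, a ∈ B.C p}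

/-- The bicommutant `P(A) = PC(PC(A) ∪ A)`. -/
def bicomm (A : Set E) : Set E := B.PC (B.PC A ∪ A)

/-- `p` is a projection cover of `a`. -/
def IsProjCover (a p : E) : Prop := p ∈ B.P ∧ ∀ q ∈ B.P, a ≤ q ↔ p ≤ q

/-- A Boolean subalgebra of `P`: a sub-effect algebra consisting of projections, any two elements
of which are Mackey compatible within it. -/
structure IsBooleanSubalgebra (S : Set E) : Prop where
  subset : S ⊆ B.P
  isSub : IsSubEffectAlgebra S
  compat : ∀ p ∈ S, ∀ q ∈ S, ∃ p₁ ∈ S, ∃ q₁ ∈ S, ∃ r ∈ S,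
    perp p₁ q₁ ∧ perp (oplus p₁ q₁) r ∧ p = oplus p₁ r ∧ q = oplus q₁ r

def HasBProperty : Prop :=
  ∀ a, ∃ S, B.IsBooleanSubalgebra S ∧ ∀ p ∈ B.P, a ∈ B.C p ↔ S ⊆ B.C p

/-- The relation `e C f` (commutation of `e` and `f`). -/
def Commutes (e f : E) : Prop := ∀ p ∈ B.bicomm {e}, ∀ q ∈ B.bicomm {f}, MackeyCompat p q

/-- The set `P_≤(e, f)`. -/
def PLe (e f : E) : Set E :=
  {p | p ∈ B.bicomm {e, f} ∧ B.J p e ≤ B.J p f ∧ B.J (orth p) f ≤ B.J (orth p) e}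

def HasBComparability : Prop :=
  B.HasBProperty ∧ ∀ e f, B.Commutes e f → (B.PLe e f).Nonempty

def HasProjCover : Prop := ∀ a, ∃ p, B.IsProjCover a p

/-- Spectrality: b-comparability and the projection cover property. -/
def IsSpectral : Prop := B.HasBComparability ∧ B.HasProjCover

/-- `x = (b - a)_+`, that is `x = J_p(b) ⊖ J_p(a)` for some `p ∈ P_≤(a, b)`
(for commuting `a`, `b`). -/
def IsPosDiff (b a x : E) : Prop :=
  B.Commutes a b ∧ ∃ p ∈ B.PLe a b, perp (B.J p a) x ∧ oplus (B.J p a) x = B.J p b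

/-- The families `c_w`, `u_w` obtained from `a` by iterated splitting. A binary string `w` of
length `n` is encoded by `n` and by the number `k < 2 ^ n` with binary expansion `w`, so that
`w0` and `w1` are encoded by `(n + 1, 2 k)` and `(n + 1, 2 k + 1)`, and the lexicographic order of
strings of the same length is the order of the numbers `k`. In `step`, with `c = c_w`, `u = u_w`:
`x = (c - cᵒ)_+`, `y = (cᵒ - c)_+` (where `cᵒ` is the orthosupplement), `r` is the projection
cover of `x`, and `z = y ∧ u`. -/
structure IsSplittingFamily (a : E) (c u : ℕ → ℕ → E) : Prop where
  c_zero : c 0 0 = a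
  u_zero : B.IsProjCover a (u 0 0)
  step : ∀ n k : ℕ, k < 2 ^ n → ∃ x y r z : E,
    B.IsPosDiff (c n k) (orth (c n k)) x ∧
    B.IsPosDiff (orth (c n k)) (c n k) y ∧
    B.IsProjCover x r ∧
    IsMeet y (u n k) z ∧
    IsMeet (orth r) (u n k) (u (n + 1) (2 * k)) ∧
    IsMeet (u n k) (orth (u (n + 1) (2 * k))) (u (n + 1) (2 * k + 1)) ∧
    (perp z (c (n + 1) (2 * k)) ∧ oplus z (c (n + 1) (2 * k)) = u (n + 1) (2 * k)) ∧
    IsMeet x (u n k) (c (n + 1) (2 * k + 1))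

/-- `b` is the binary spectral resolution of `a`; only its values at the dyadic rationals of
`[0, 1]` are meaningful. -/
def IsBinarySpectralResolution (a : E) (b : ℚ → E) : Prop :=
  ∃ c u : ℕ → ℕ → E, B.IsSplittingFamily a c u ∧
    b 0 = orth (u 0 0) ∧ b 1 = 1 ∧
    ∀ n k : ℕ, k < 2 ^ n →
      OSumsTo (orth (u 0 0)) (u (n + 1)) (2 * k + 1)
        (b (((2 * k + 1 : ℕ) : ℚ) / 2 ^ (n + 1)))

/-- `p` is the rational spectral resolution of `a`: for `l ∈ [0, 1)`, the element `p l` is the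
infimum of the binary spectral resolution over the dyadic rationals `m ∈ (l, 1]`; as usual
`p l = 0` for `l < 0` and `p l = 1` for `l ≥ 1`. -/
def IsRationalSpectralResolution (a : E) (p : ℚ → E) : Prop :=
  ∃ b : ℚ → E, B.IsBinarySpectralResolution a b ∧
    (∀ l : ℚ, l < 0 → p l = 0) ∧
    (∀ l : ℚ, 0 ≤ l → l < 1 →
      IsGLB {x | ∃ m : ℚ, l < m ∧ m ≤ 1 ∧ (∃ k n : ℕ, m = (k : ℚ) / 2 ^ n) ∧ x = b m} (p l)) ∧
    (∀ l : ℚ, 1 ≤ l → p l = 1)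

end CompressionBase

/-! ## Convex effect algebras -/

/-- A convex effect algebra; `cmul l a` is the element `l a`, meaningful for `0 ≤ l ≤ 1`. -/
class ConvexEffectAlgebra (E : Type*) extends EffectAlgebra E where
  cmul : ℝ → E → E
  cmul_cmul : ∀ l m a, l ∈ Set.Icc (0 : ℝ) 1 → m ∈ Set.Icc (0 : ℝ) 1 →
    cmul m (cmul l a) = cmul (l * m) a
  add_cmul : ∀ l m a, 0 ≤ l → 0 ≤ m → l + m ≤ 1 →
    perp (cmul l a) (cmul m a) ∧ cmul (l + m) a = oplus (cmul l a) (cmul m a)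
  cmul_oplus : ∀ l a b, l ∈ Set.Icc (0 : ℝ) 1 → perp a b →
    perp (cmul l a) (cmul l b) ∧ cmul l (oplus a b) = oplus (cmul l a) (cmul l b)
  one_cmul : ∀ a, cmul 1 a = a

/-- If `b ⊕ (1/n) c` is defined and `a ≤ b ⊕ (1/n) c` for all `n ≥ 1`, then `a ≤ b`. -/
def IsStronglyArchimedean (E : Type*) [ConvexEffectAlgebra E] : Prop :=
  ∀ a b c : E, (∀ n : ℕ, 1 ≤ n →
    perp b (ConvexEffectAlgebra.cmul (1 / (n : ℝ)) c) ∧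
    a ≤ oplus b (ConvexEffectAlgebra.cmul (1 / (n : ℝ)) c)) → a ≤ b

section Vector

universe v

variable {V : Type v} [AddCommGroup V] [PartialOrder V] [IsOrderedAddMonoid V] [Module ℝ V]
  [IsOrderedModule ℝ V]

/-- `u` is an order unit. -/
def IsOrderUnit (u : V) : Prop := 0 ≤ u ∧ ∀ x : V, ∃ n : ℕ, x ≤ n • u

/-- `(V, V⁺, u)` is an order unit space: `u` is an order unit and `V` is archimedean. -/
def IsOrderUnitSpace (u : V) : Prop :=
  IsOrderUnit u ∧ ∀ x y : V, (∀ n : ℕ, n • x ≤ y) → x ≤ 0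

/-- The ordered vector space `V` with the order unit `u` and the embedding `i : E → V` is the
universal group of the convex effect algebra `E`: `i` is an affine isomorphism of `E` onto the
unit interval `V[0, u]`, and every additive map from `E` into an abelian group extends uniquely to
a group homomorphism on `V`. -/
structure IsUniversalVectorSpace {E : Type*} [ConvexEffectAlgebra E] (u : V) (i : E → V) :
    Prop where
  orderUnit : IsOrderUnit u
  injective : Function.Injective i
  range_eq : Set.range i = Set.Icc 0 u
  map_one : i 1 = u
  perp_iff : ∀ a b : E, perp a b ↔ i a + i b ≤ u
  map_oplus : ∀ a b : E, perp a b → i (oplus a b) = i a + i b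
  map_cmul : ∀ (l : ℝ) (a : E), l ∈ Set.Icc (0 : ℝ) 1 →
    i (ConvexEffectAlgebra.cmul l a) = l • i a
  universal : ∀ (H : Type v) [AddCommGroup H] (f : E → H),
    (∀ a b, perp a b → f (oplus a b) = f a + f b) → ∃! g : V →+ H, ∀ a, g (i a) = f a

/-- A compression base on `(V, V⁺, u)`, consisting of linear maps. Only the maps `J p` with
`p ∈ P` are meaningful. -/
structure LinearCompressionBase (u : V) where
  P : Set V
  J : V → V →ₗ[ℝ] V
  subset : P ⊆ Set.Icc 0 u
  unit_mem : u ∈ P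
  compl_mem : ∀ p ∈ P, u - p ∈ P
  add_mem : ∀ p ∈ P, ∀ q ∈ P, p + q ≤ u → p + q ∈ P
  positive : ∀ p ∈ P, ∀ x, 0 ≤ x → 0 ≤ J p x
  focus : ∀ p ∈ P, J p u = p
  apply_of_le : ∀ p ∈ P, ∀ x, 0 ≤ x → x ≤ p → J p x = x
  apply_eq_zero_iff : ∀ p ∈ P, ∀ x, 0 ≤ x → x ≤ u → (J p x = 0 ↔ x ≤ u - p)
  comp : ∀ p ∈ P, ∀ q ∈ P,
    (∃ p₁ q₁ c : V, 0 ≤ p₁ ∧ 0 ≤ q₁ ∧ 0 ≤ c ∧ p₁ + q₁ + c ≤ u ∧ p = p₁ + c ∧ q = q₁ + c) →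
    ∃ r ∈ P, ∀ x, J p (J q x) = J r x

namespace LinearCompressionBase

variable {u : V} (D : LinearCompressionBase u)

/-- The commutant of a projection. -/
def C (p : V) : Set V := {x | x = D.J p x + D.J (u - p) x}

def PC (A : Set V) : Set V := {p | p ∈ D.P ∧ ∀ x ∈ A, x ∈ D.C p}

/-- The bicommutant `P(g)`. -/
def bicomm (g : V) : Set V := D.PC (D.PC {g} ∪ {g})

def HasGeneralComparability : Prop :=
  ∀ g : V, ∃ p ∈ D.bicomm g, D.J (u - p) g ≤ 0 ∧ 0 ≤ D.J p g

/-- `r = g^*`, the value at `g` of the Rickart mapping. -/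
def IsRickartStar (g r : V) : Prop :=
  r ∈ D.P ∧ ∀ p ∈ D.P, p ≤ r ↔ (g ∈ D.C p ∧ D.J p g = 0)

def IsRickart : Prop := ∀ g : V, ∃ r, D.IsRickartStar g r

/-- `(V, V⁺, u)` with the compression base `D` is a spectral order unit space. -/
def IsSpectralOrderUnitSpace : Prop :=
  IsOrderUnitSpace u ∧ D.HasGeneralComparability ∧ D.IsRickart

/-- `g = x - y` is an orthogonal decomposition of `g`, that is `x = g_+` and `y = g_-`. -/
def IsOrthogonalDecomposition (g x y : V) : Prop :=
  0 ≤ x ∧ 0 ≤ y ∧ g = x - y ∧ ∃ p ∈ D.P, D.J p g = x ∧ D.J (u - p) g = -y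

/-- `q` is the spectral projection `((g - l u)_+)^*` of `g` at `l`. -/
def IsSpectralProjection (g : V) (l : ℝ) (q : V) : Prop :=
  ∃ x y, D.IsOrthogonalDecomposition (g - l • u) x y ∧ D.IsRickartStar x q

/-- `D` extends the compression base `B` of `E` along `i : E → V`, and each `D.J (i p)` is
the only additive map on `V` which extends `J_p`. -/
def IsUniqueExtension {E : Type*} [EffectAlgebra E] (i : E → V) (B : CompressionBase E) : Prop :=
  D.P = i '' B.P ∧
  (∀ p ∈ B.P, ∀ a, D.J (i p) (i a) = i (B.J p a)) ∧
  ∀ p ∈ B.P, ∀ f : V →+ V, (∀ a, f (i a) = i (B.J p a)) → ∀ x, f x = D.J (i p) x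

end LinearCompressionBase

/-- The order unit norm. -/
noncomputable def orderUnitNorm (u x : V) : ℝ :=
  sInf {r : ℝ | 0 ≤ r ∧ -(r • u) ≤ x ∧ x ≤ r • u}

/-- `I = ∫_s^t f dF` as a Riemann-Stieltjes integral: the limit, in the order unit norm and as the
mesh tends to `0`, of the sums `∑ f(ξ_j) (F(τ_{j+1}) - F(τ_j))` over all partitions
`s = τ_0 ≤ τ_1 ≤ ⋯ ≤ τ_N = t` and all `ξ_j ∈ [τ_j, τ_{j+1}]`. -/
def HasRiemannStieltjesIntegral (u : V) (f : ℝ → ℝ) (F : ℝ → V) (s t : ℝ) (I : V) : Prop :=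
  ∀ ε : ℝ, 0 < ε → ∃ δ : ℝ, 0 < δ ∧
    ∀ (N : ℕ) (τ ξ : ℕ → ℝ), τ 0 = s → τ N = t →
      (∀ j < N, τ j ≤ ξ j ∧ ξ j ≤ τ (j + 1) ∧ τ (j + 1) - τ j < δ) →
      orderUnitNorm u (I - ∑ j ∈ Finset.range N, f (ξ j) • (F (τ (j + 1)) - F (τ j))) < ε

end Vector

/-! Everything is moved to the vector space. Up to a positive factor, each vector is `i a - i (orth
a)` for some `a` in E (`exists_sub_orth`), and `a` always commutes with `orth a` (`commutes_orth`).
Comparability in E therefore splits every vector into a positive and a negative part by means of a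
projection. If all multiples of a vector stay below a fixed multiple of `u`, archimedeanity of E
kills its positive part, so V is archimedean (`isOrderUnitSpace`). Positive additive maps on V are
then linear, and the compressions, extended through the universal property, form a linear
compression base. Comparability carries over, and the projection cover of a rescaled absolute value
of `g` is the complement of `g^*` (`isRickart`).

In the resulting spectral order unit space, `a` has a monotone, right continuous spectral family
`e`, and on the slice `e m - e l` it lies between `l` and `m`. Summing over the slices of a
partition gives the Riemann-Stieltjes integral.

The core is to recognise the recursive construction in E. For a string of length `n` with value `k`,
induction gives `u_w = e ((k+1)/2^n) - e (k/2^n)` and `c_w = J_{u_w} (2^n a - k u)`, that is, `a` on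
a dyadic slice, rescaled to run from 0 to 1. Comparing `c_w` with its orthosupplement asks where it
exceeds 1/2, so it cuts the slice at its midpoint (`splitting_step_iff`). Since orthogonal
decompositions are unique, each step is forced. The `u_w` telescope to `e` at dyadic points, and
right continuity (`le_of_forall_pos`) passes from these to rational and then real points. -/

set_option linter.unusedSectionVars false

/-! ### Positive additive maps on archimedean ordered vector spaces -/

section Additive

variable {V : Type*} [AddCommGroup V] [PartialOrder V] [IsOrderedAddMonoid V] [Module ℝ V]
  [IsOrderedModule ℝ V]

theorem IsOrderUnit.exists_abs_le {u : V} (hu : IsOrderUnit u) (x : V) :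
    ∃ r : ℝ, 0 < r ∧ -(r • u) ≤ x ∧ x ≤ r • u := by
  obtain ⟨n, hn⟩ := hu.2 x
  obtain ⟨m, hm⟩ := hu.2 (-x)
  rw [← Nat.cast_smul_eq_nsmul ℝ] at hn hm
  have key : ∀ k : ℝ, k ≤ (n : ℝ) + m + 1 → k • u ≤ ((n : ℝ) + m + 1) • u := fun k hk =>
    smul_le_smul_of_nonneg_right hk hu.1
  refine ⟨n + m + 1, by positivity, ?_, hn.trans (key _ ?_)⟩
  · rw [neg_le]
    exact hm.trans (key _ (by linarith [(Nat.cast_nonneg n : (0 : ℝ) ≤ n)]))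
  · linarith [(Nat.cast_nonneg m : (0 : ℝ) ≤ m)]

/-- A positive additive map on an order unit space is linear. -/
theorem IsOrderUnitSpace.map_smul_of_nonneg {u : V} (hu : IsOrderUnitSpace u) (f : V →+ V)
    (hf : ∀ x, 0 ≤ x → 0 ≤ f x) (r : ℝ) (x : V) : f (r • x) = r • f x := by
  have hmono : ∀ x y, x ≤ y → f x ≤ f y := fun x y h => by
    have := hf (y - x) (sub_nonneg.2 h)
    rwa [map_sub, sub_nonneg] at this
  have key : ∀ x, 0 ≤ x → f (r • x) = r • f x := by
    intro x hx
    -- An additive map is exact on the integer part of `n * r`, so `n` times the defect equals the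
    -- defect at the fractional part, which lies between `-f x` and `f x` whatever `n` is.
    have hb : ∀ n : ℕ, n • (f (r • x) - r • f x) ≤ f x ∧ n • -(f (r • x) - r • f x) ≤ f x := by
      intro n
      have h0 := Int.fract_nonneg ((n : ℝ) * r)
      have h1 := (Int.fract_lt_one ((n : ℝ) * r)).le
      have e : n • (f (r • x) - r • f x) =
          f (Int.fract ((n : ℝ) * r) • x) - Int.fract ((n : ℝ) * r) • f x := by
        have e1 : n • (r • x) =
            ⌊(n : ℝ) * r⌋ • x + Int.fract ((n : ℝ) * r) • x := by
          rw [← Int.cast_smul_eq_zsmul ℝ, ← add_smul, Int.floor_add_fract, mul_smul,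
            Nat.cast_smul_eq_nsmul]
        have e2 : n • (r • f x) =
            ⌊(n : ℝ) * r⌋ • f x + Int.fract ((n : ℝ) * r) • f x := by
          rw [← Int.cast_smul_eq_zsmul ℝ, ← add_smul, Int.floor_add_fract, mul_smul,
            Nat.cast_smul_eq_nsmul]
        rw [smul_sub, ← map_nsmul, e1, e2, map_add, map_zsmul]
        abel
      have b1 : f (Int.fract ((n : ℝ) * r) • x) ≤ f x :=
        hmono _ _ (smul_le_of_le_one_left hx h1)
      have b2 : 0 ≤ f (Int.fract ((n : ℝ) * r) • x) := hf _ (smul_nonneg h0 hx)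
      have b3 : Int.fract ((n : ℝ) * r) • f x ≤ f x := smul_le_of_le_one_left (hf x hx) h1
      have b4 : 0 ≤ Int.fract ((n : ℝ) * r) • f x := smul_nonneg h0 (hf x hx)
      rw [smul_neg, e, neg_sub]
      exact ⟨(sub_le_self _ b4).trans b1, (sub_le_self _ b2).trans b3⟩
    refine sub_eq_zero.1 (le_antisymm (hu.2 _ _ fun n => (hb n).1) ?_)
    exact neg_nonpos.1 (hu.2 _ _ fun n => (hb n).2)
  -- A general `x` is the difference of the positive vectors `x + s • u` and `s • u`.
  obtain ⟨s, hs, h1, -⟩ := hu.1.exists_abs_le x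
  have h2 : 0 ≤ x + s • u := by rwa [← neg_le_iff_add_nonneg]
  have h3 := key _ h2
  have h4 := key _ (smul_nonneg hs.le hu.1.1)
  rwa [smul_add, map_add, h4, map_add, smul_add, add_left_inj] at h3

end Additive

/-! ### Dictionary between the effect algebra and the unit interval -/

namespace IsUniversalVectorSpace

variable {E : Type*} [ConvexEffectAlgebra E]
    {V : Type*} [AddCommGroup V] [PartialOrder V] [IsOrderedAddMonoid V] [Module ℝ V]
    [IsOrderedModule ℝ V] {u : V} {i : E → V}

theorem nonneg (hV : IsUniversalVectorSpace u i) (a : E) : 0 ≤ i a :=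
  (hV.range_eq ▸ Set.mem_range_self a : i a ∈ Set.Icc 0 u).1

theorem le_unit (hV : IsUniversalVectorSpace u i) (a : E) : i a ≤ u :=
  (hV.range_eq ▸ Set.mem_range_self a : i a ∈ Set.Icc 0 u).2

theorem exists_eq (hV : IsUniversalVectorSpace u i) {x : V} (h0 : 0 ≤ x) (h1 : x ≤ u) :
    ∃ a, i a = x := by
  have : x ∈ Set.range i := hV.range_eq ▸ ⟨h0, h1⟩
  exact this

theorem oplus_eq_iff (hV : IsUniversalVectorSpace u i) {a b c : E} :
    (perp a b ∧ oplus a b = c) ↔ i a + i b = i c := by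
  constructor
  · rintro ⟨h, rfl⟩
    exact (hV.map_oplus a b h).symm
  · intro h
    have hp : perp a b := (hV.perp_iff a b).2 (h ▸ hV.le_unit c)
    exact ⟨hp, hV.injective (by rw [hV.map_oplus a b hp, h])⟩

theorem map_zero (hV : IsUniversalVectorSpace u i) : i 0 = 0 := by
  simpa using hV.oplus_eq_iff.1 (perp_zero_oplus_zero (0 : E))

theorem map_orth (hV : IsUniversalVectorSpace u i) (a : E) : i (orth a) = u - i a := by
  rw [eq_sub_iff_add_eq', ← hV.map_one, ← hV.oplus_eq_iff]
  exact ⟨perp_orth a, oplus_orth a⟩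

theorem le_iff (hV : IsUniversalVectorSpace u i) {a b : E} : a ≤ b ↔ i a ≤ i b := by
  constructor
  · rintro ⟨c, hc⟩
    rw [← hV.oplus_eq_iff.1 hc]
    exact le_add_of_nonneg_right (hV.nonneg c)
  · intro h
    obtain ⟨c, hc⟩ := hV.exists_eq (sub_nonneg.2 h)
      ((sub_le_self _ (hV.nonneg a)).trans (hV.le_unit b))
    exact ⟨c, hV.oplus_eq_iff.2 (by rw [hc]; abel)⟩

theorem mackeyCompat_iff (hV : IsUniversalVectorSpace u i) {a b : E} :
    MackeyCompat a b ↔ ∃ x y z : V, 0 ≤ x ∧ 0 ≤ y ∧ 0 ≤ z ∧ x + y + z ≤ u ∧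
      i a = x + z ∧ i b = y + z := by
  constructor
  · rintro ⟨a₁, b₁, c, h1, h2, h3, h4⟩
    have e := hV.map_oplus _ _ h1
    have s := (hV.perp_iff _ _).1 h2
    rw [e] at s
    have p1 : perp a₁ c := (hV.perp_iff _ _).2
      ((add_le_add_left (le_add_of_nonneg_right (hV.nonneg b₁)) _).trans s)
    have p2 : perp b₁ c := (hV.perp_iff _ _).2
      ((add_le_add_left (le_add_of_nonneg_left (hV.nonneg a₁)) _).trans s)
    exact ⟨i a₁, i b₁, i c, hV.nonneg _, hV.nonneg _, hV.nonneg _, s,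
      by rw [h3, hV.map_oplus _ _ p1], by rw [h4, hV.map_oplus _ _ p2]⟩
  · rintro ⟨x, y, z, hx, hy, hz, hs, ha, hb⟩
    obtain ⟨a₁, rfl⟩ := hV.exists_eq hx
      ((le_add_of_nonneg_right hy).trans ((le_add_of_nonneg_right hz).trans hs))
    obtain ⟨b₁, rfl⟩ := hV.exists_eq hy
      ((le_add_of_nonneg_left hx).trans ((le_add_of_nonneg_right hz).trans hs))
    obtain ⟨c, rfl⟩ := hV.exists_eq hz ((le_add_of_nonneg_left (add_nonneg hx hy)).trans hs)
    have h1 : perp a₁ b₁ := (hV.perp_iff _ _).2 ((le_add_of_nonneg_right hz).trans hs)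
    refine ⟨a₁, b₁, c, h1, (hV.perp_iff _ _).2 (by rwa [hV.map_oplus _ _ h1]), ?_, ?_⟩
    · exact (hV.oplus_eq_iff.2 ha.symm).2.symm
    · exact (hV.oplus_eq_iff.2 hb.symm).2.symm

/-- Definedness of the intermediate sums comes for free: they are dominated by the total, which is
at most `u`. -/
theorem oSumsTo_iff (hV : IsUniversalVectorSpace u i) {x : E} {f : ℕ → E} {m : ℕ} {s : E} :
    OSumsTo x f m s ↔ i s = i x + ∑ j ∈ Finset.range m, i (f j) := by
  induction m generalizing s with
  | zero => simpa [OSumsTo] using hV.injective.eq_iff.symm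
  | succ m ih =>
    simp only [OSumsTo]
    constructor
    · rintro ⟨t, ht, h⟩
      rw [← hV.oplus_eq_iff.1 h, ih.1 ht, Finset.sum_range_succ, add_assoc]
    · intro h
      rw [Finset.sum_range_succ, ← add_assoc] at h
      have h0 : 0 ≤ i x + ∑ j ∈ Finset.range m, i (f j) :=
        add_nonneg (hV.nonneg x) (Finset.sum_nonneg fun j _ => hV.nonneg _)
      obtain ⟨t, ht⟩ := hV.exists_eq h0
        ((le_add_of_nonneg_right (hV.nonneg (f m))).trans (h ▸ hV.le_unit s))
      exact ⟨t, ih.2 ht, hV.oplus_eq_iff.2 (by rw [ht, h])⟩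

/-- Take `a = (g + r u) / (2 r)`, so that `a - a' = 2 a - u = g / r`. This reduces questions about
the sign of a vector to the comparison of `a` with its orthosupplement. -/
theorem exists_sub_orth (hV : IsUniversalVectorSpace u i) (g : V) :
    ∃ (r : ℝ) (a : E), 0 < r ∧ g = r • (i a - i (orth a)) := by
  obtain ⟨r, hr, h1, h2⟩ := hV.orderUnit.exists_abs_le g
  have h3 : 0 ≤ g + r • u := by rwa [← neg_le_iff_add_nonneg]
  have h4 : g + r • u ≤ (2 * r) • u := by
    rw [two_mul, add_smul]; exact add_le_add_left h2 _
  obtain ⟨a, ha⟩ := hV.exists_eq (x := (2 * r)⁻¹ • (g + r • u))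
    (smul_nonneg (by positivity) h3) (by rwa [inv_smul_le_iff_of_pos (by positivity)])
  refine ⟨r, a, hr, ?_⟩
  rw [hV.map_orth, ha]
  have : g = (r * (2 * r)⁻¹ + r * (2 * r)⁻¹) • g + (r * ((2 * r)⁻¹ * r) +
      r * ((2 * r)⁻¹ * r) - r) • u := by
    have e1 : r * (2 * r)⁻¹ + r * (2 * r)⁻¹ = 1 := by field_simp; norm_num
    have e2 : r * ((2 * r)⁻¹ * r) + r * ((2 * r)⁻¹ * r) - r = 0 := by field_simp; ring
    rw [e1, e2]; simp
  conv_lhs => rw [this]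
  module

end IsUniversalVectorSpace

/-! ### Calculus of linear compression bases -/

namespace LinearCompressionBase

variable {V : Type*} [AddCommGroup V] [PartialOrder V] [IsOrderedAddMonoid V] [Module ℝ V]
    [IsOrderedModule ℝ V] {u : V} (D : LinearCompressionBase u)

variable {D} {p q r s t g x y : V}

theorem nonneg_of_mem (hp : p ∈ D.P) : 0 ≤ p := (D.subset hp).1

theorem le_unit_of_mem (hp : p ∈ D.P) : p ≤ u := (D.subset hp).2

theorem J_mono (hp : p ∈ D.P) (h : x ≤ y) : D.J p x ≤ D.J p y := by
  have := D.positive p hp (y - x) (sub_nonneg.2 h)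
  rwa [map_sub, sub_nonneg] at this

theorem J_nonpos (hp : p ∈ D.P) (h : x ≤ 0) : D.J p x ≤ 0 := by
  simpa using J_mono hp h

theorem J_le_smul (hp : p ∈ D.P) {c : ℝ} (h : x ≤ c • u) : D.J p x ≤ c • p := by
  simpa [D.focus p hp] using J_mono hp h

theorem J_eq_self (hp : p ∈ D.P) {c : ℝ} (hc : 0 ≤ c) (h0 : 0 ≤ x) (h : x ≤ c • p) :
    D.J p x = x := by
  rcases hc.eq_or_lt with rfl | hc
  · rw [le_antisymm (by simpa using h) h0, map_zero]
  · have := D.apply_of_le p hp (c⁻¹ • x) (smul_nonneg (by positivity) h0)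
      ((inv_smul_le_iff_of_pos hc).2 h)
    rwa [map_smul, smul_right_inj (by positivity)] at this

theorem J_self (hp : p ∈ D.P) : D.J p p = p :=
  D.apply_of_le p hp p (nonneg_of_mem hp) le_rfl

theorem J_eq_zero (hp : p ∈ D.P) {c : ℝ} (h0 : 0 ≤ x) (h : x ≤ c • (u - p)) :
    D.J p x = 0 := by
  refine le_antisymm ((J_mono hp h).trans ?_) (D.positive p hp x h0)
  rw [map_smul, map_sub, D.focus p hp, J_self hp]
  simp

theorem le_smul_compl (hp : p ∈ D.P) {c : ℝ} (hc : 0 < c) (h0 : 0 ≤ x) (h : x ≤ c • u)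
    (hx : D.J p x = 0) : x ≤ c • (u - p) := by
  rw [← inv_smul_le_iff_of_pos hc] at h ⊢
  exact (D.apply_eq_zero_iff p hp _ (smul_nonneg (by positivity) h0) h).1 (by simp [hx])

theorem J_unit (hu : IsOrderUnit u) : D.J u x = x := by
  obtain ⟨c, hc, h1, h2⟩ := hu.exists_abs_le x
  have h3 : 0 ≤ x + c • u := by rwa [← neg_le_iff_add_nonneg]
  have h4 : x + c • u ≤ (c + c) • u := by rw [add_smul]; exact add_le_add_left h2 _
  have := J_eq_self D.unit_mem (by positivity) h3 h4
  rwa [map_add, map_smul, D.focus u D.unit_mem, add_left_inj] at this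

/-- After a shift by a multiple of `u`, the image under `J q` is positive and below a multiple of
`q`, hence of `u - p`, and `J p` kills it. The shift itself contributes a multiple of `J p q = 0`.
-/
theorem J_J_of_le_compl (hu : IsOrderUnit u) (hp : p ∈ D.P) (hq : q ∈ D.P) (h : q ≤ u - p) :
    D.J p (D.J q x) = 0 := by
  obtain ⟨c, hc, h1, h2⟩ := hu.exists_abs_le x
  have h3 : 0 ≤ x + c • u := by rwa [← neg_le_iff_add_nonneg]
  have h4 : x + c • u ≤ (c + c) • u := by rw [add_smul]; exact add_le_add_left h2 _
  have h5 : D.J q (x + c • u) ≤ (c + c) • (u - p) :=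
    (J_le_smul hq h4).trans (smul_le_smul_of_nonneg_left h (by positivity))
  have := J_eq_zero hp (D.positive q hq _ h3) h5
  have h6 : D.J p q = 0 := J_eq_zero (c := 1) hp (nonneg_of_mem hq) (by simpa using h)
  rwa [map_add, map_add, map_smul, map_smul, D.focus q hq, h6, smul_zero, add_zero] at this

theorem mem_C_iff : x ∈ D.C p ↔ x = D.J p x + D.J (u - p) x := Iff.rfl

theorem mem_C_compl : x ∈ D.C (u - p) ↔ x ∈ D.C p := by
  rw [mem_C_iff, mem_C_iff, sub_sub_cancel, add_comm]

theorem unit_mem_C (hp : p ∈ D.P) : u ∈ D.C p := by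
  rw [mem_C_iff, D.focus p hp, D.focus _ (D.compl_mem p hp)]; abel

theorem add_mem_C (hx : x ∈ D.C p) (hy : y ∈ D.C p) : x + y ∈ D.C p := by
  rw [mem_C_iff] at *
  conv_lhs => rw [hx, hy]
  simp only [map_add]; abel

theorem smul_mem_C (c : ℝ) (hx : x ∈ D.C p) : c • x ∈ D.C p := by
  rw [mem_C_iff] at *
  conv_lhs => rw [hx]
  simp only [map_smul, smul_add]

theorem sub_mem_C (hx : x ∈ D.C p) (hy : y ∈ D.C p) : x - y ∈ D.C p := by
  rw [mem_C_iff] at *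
  conv_lhs => rw [hx, hy]
  simp only [map_sub]; abel

theorem J_compl_of_mem_C (hx : x ∈ D.C p) : D.J (u - p) x = x - D.J p x :=
  eq_sub_of_add_eq' (mem_C_iff.1 hx).symm

/-- Compatible projections have commuting compressions. -/
theorem comm_aux (hp : p ∈ D.P) (hq : q ∈ D.P) (h : q ∈ D.C p) :
    D.J p q ∈ D.P ∧ (∀ x, D.J p (D.J q x) = D.J (D.J p q) x) ∧
      (∀ x, D.J q (D.J p x) = D.J (D.J p q) x) := by
  have hp' := D.compl_mem p hp
  have hcp : D.J p q ≤ p := by simpa using J_le_smul hp (c := 1) (by simpa using le_unit_of_mem hq)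
  have hqp : D.J (u - p) q ≤ u - p := by
    simpa using J_le_smul hp' (c := 1) (by simpa using le_unit_of_mem hq)
  have hc0 := D.positive p hp q (nonneg_of_mem hq)
  have hq0 := D.positive _ hp' q (nonneg_of_mem hq)
  have hsum : p + D.J (u - p) q ≤ u := by
    rw [add_comm]; exact le_sub_iff_add_le.1 hqp
  obtain ⟨r, hr, h1⟩ := D.comp p hp q hq ⟨p - D.J p q, D.J (u - p) q, D.J p q,
    sub_nonneg.2 hcp, hq0, hc0, by convert hsum using 1; abel, by abel, by rw [add_comm]; exact h⟩
  obtain ⟨r', hr', h2⟩ := D.comp q hq p hp ⟨D.J (u - p) q, p - D.J p q, D.J p q,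
    hq0, sub_nonneg.2 hcp, hc0, by convert hsum using 1; abel, by rw [add_comm]; exact h, by abel⟩
  have er : r = D.J p q := by rw [← D.focus r hr, ← h1, D.focus q hq]
  have er' : r' = D.J p q := by
    have e1 : D.J q (p - D.J p q) = 0 := by
      refine J_eq_zero (c := 1) hq (sub_nonneg.2 hcp) ?_
      rw [one_smul, le_sub_iff_add_le]
      rw [J_compl_of_mem_C h] at hsum
      convert hsum using 1; abel
    have e2 : D.J q (D.J p q) = D.J p q := by
      refine D.apply_of_le q hq _ hc0 ?_
      conv_rhs => rw [mem_C_iff.1 h]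
      exact le_add_of_nonneg_right hq0
    rw [← D.focus r' hr', ← h2, D.focus p hp]
    rw [map_sub, sub_eq_zero] at e1
    rw [e1, e2]
  subst er
  exact ⟨hr, h1, fun x => by rw [h2, er']⟩

theorem J_comm (hp : p ∈ D.P) (hq : q ∈ D.P) (h : q ∈ D.C p) (x : V) :
    D.J p (D.J q x) = D.J q (D.J p x) := by
  obtain ⟨-, h1, h2⟩ := comm_aux hp hq h
  rw [h1, h2]

theorem mem_C_J (hp : p ∈ D.P) (hq : q ∈ D.P) (h : q ∈ D.C p) (hg : g ∈ D.C p) :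
    D.J q g ∈ D.C p := by
  have h' := J_comm (D.compl_mem p hp) hq (mem_C_compl.2 h)
  rw [mem_C_iff, J_comm hp hq h, h', ← map_add, ← mem_C_iff.1 hg]

theorem mem_C_symm (hp : p ∈ D.P) (hq : q ∈ D.P) (h : q ∈ D.C p) : p ∈ D.C q := by
  have h1 := J_comm hp hq h u
  have h2 := J_comm hp (D.compl_mem q hq) (sub_mem_C (unit_mem_C hp) h) u
  rw [D.focus p hp, D.focus q hq] at h1
  rw [D.focus p hp, D.focus _ (D.compl_mem q hq), map_sub, D.focus p hp] at h2
  rw [mem_C_iff, ← h1, ← h2]; abel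

theorem mem_C_of_le (hp : p ∈ D.P) (h0 : 0 ≤ x) (hx : x ≤ p) : x ∈ D.C p := by
  have h2 : D.J (u - p) x = 0 := by
    have := J_eq_zero (c := 1) (D.compl_mem p hp) h0 (by simpa using hx)
    exact this
  rw [mem_C_iff, D.apply_of_le p hp x h0 hx, h2, add_zero]

theorem sub_mem (hp : p ∈ D.P) (hq : q ∈ D.P) (h : p ≤ q) : q - p ∈ D.P := by
  have := D.compl_mem _ (D.add_mem _ (D.compl_mem q hq) p hp (by
    rw [sub_add_eq_add_sub]; exact sub_le_iff_le_add.2 (by gcongr)))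
  convert this using 1; abel

theorem J_of_le (hp : p ∈ D.P) (hq : q ∈ D.P) (h : p ≤ q) (x : V) :
    D.J q (D.J p x) = D.J p x ∧ D.J p (D.J q x) = D.J p x := by
  obtain ⟨-, h1, h2⟩ := comm_aux hq hp (mem_C_of_le hq (nonneg_of_mem hp) h)
  rw [D.apply_of_le q hq p (nonneg_of_mem hp) h] at h1 h2
  exact ⟨h1 x, h2 x⟩

/-- Here `J (q - p)` is the composite of `J q` and `J (u - p)`; commutation of `x` with `p` turns `J
(u - p) x` into `x - J p x`. -/
theorem J_sub (hp : p ∈ D.P) (hq : q ∈ D.P) (h : p ≤ q) (hx : x ∈ D.C p) :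
    D.J (q - p) x = D.J q x - D.J p x := by
  obtain ⟨-, h1, -⟩ := comm_aux hq (D.compl_mem p hp)
    (sub_mem_C (unit_mem_C hq) (mem_C_of_le hq (nonneg_of_mem hp) h))
  rw [map_sub, D.focus q hq, D.apply_of_le q hq p (nonneg_of_mem hp) h] at h1
  rw [← h1, J_compl_of_mem_C hx, map_sub, (J_of_le hp hq h x).1]

theorem J_add (hp : p ∈ D.P) (hq : q ∈ D.P) (h : p + q ≤ u) (hx : x ∈ D.C q) :
    D.J (p + q) x = D.J p x + D.J q x := by
  have := J_sub hq (D.add_mem p hp q hq h) (le_add_of_nonneg_left (nonneg_of_mem hp)) hx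
  rw [add_sub_cancel_right] at this
  rw [this]; abel

theorem mem_C_sub (hp : p ∈ D.P) (hq : q ∈ D.P) (h : p ≤ q)
    (hx : x ∈ D.C p) (hx' : x ∈ D.C q) : x ∈ D.C (q - p) := by
  have e : u - (q - p) = (u - q) + p := by abel
  have h1 : (u - q) + p ≤ u := by
    rw [sub_add_eq_add_sub]; exact sub_le_iff_le_add.2 (by gcongr)
  rw [mem_C_iff, e, J_add (D.compl_mem q hq) hp h1 hx, J_sub hp hq h hx, J_compl_of_mem_C hx']
  abel

/-- A positive vector killed by `J p` lies below a multiple of `u - p` and is fixed by `J (u - p)`.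
So for positive vectors the commutation clause in the definition of `g^*` is automatic. -/
theorem mem_C_of_J_eq_zero (hu : IsOrderUnit u) (hp : p ∈ D.P) (h0 : 0 ≤ x)
    (h : D.J p x = 0) : x ∈ D.C p := by
  obtain ⟨c, hc, -, h2⟩ := hu.exists_abs_le x
  rw [mem_C_iff, h, zero_add,
    J_eq_self (D.compl_mem p hp) hc.le h0 (le_smul_compl hp hc h0 h2 h)]

theorem IsOrthogonalDecomposition.of_mem (hp : p ∈ D.P) (hg : g ∈ D.C p)
    (h0 : 0 ≤ D.J p g) (h1 : D.J (u - p) g ≤ 0) :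
    D.IsOrthogonalDecomposition g (D.J p g) (-D.J (u - p) g) :=
  ⟨h0, neg_nonneg.2 h1, by rw [sub_neg_eq_add]; exact hg, p, hp, rfl, (neg_neg _).symm⟩

theorem IsOrthogonalDecomposition.mem_C (h : D.IsOrthogonalDecomposition g x y) :
    ∃ p ∈ D.P, g ∈ D.C p ∧ D.J p g = x ∧ D.J (u - p) g = -y := by
  obtain ⟨-, -, h3, p, hp, h4, h5⟩ := h
  exact ⟨p, hp, by rw [mem_C_iff, h4, h5, h3, sub_eq_add_neg], h4, h5⟩

theorem IsOrthogonalDecomposition.neg (h : D.IsOrthogonalDecomposition g x y) :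
    D.IsOrthogonalDecomposition (-g) y x := by
  obtain ⟨h1, h2, h3, p, hp, h4, h5⟩ := h
  refine ⟨h2, h1, by rw [h3, neg_sub], u - p, D.compl_mem p hp, ?_, ?_⟩
  · rw [map_neg, h5, neg_neg]
  · rw [map_neg, sub_sub_cancel, h4]

theorem IsOrthogonalDecomposition.le_unit (h : D.IsOrthogonalDecomposition g x y) (hg : g ≤ u) :
    x ≤ u := by
  obtain ⟨-, -, -, p, hp, rfl, -⟩ := h
  have := J_le_smul hp (c := 1) (x := g) (by rwa [one_smul])
  rw [one_smul] at this
  exact this.trans (le_unit_of_mem hp)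

theorem mem_bicomm_iff : p ∈ D.bicomm g ↔
    p ∈ D.P ∧ g ∈ D.C p ∧ ∀ q ∈ D.P, g ∈ D.C q → q ∈ D.C p := by
  constructor
  · rintro ⟨h1, h2⟩
    refine ⟨h1, h2 _ (Or.inr rfl), fun q hq hg => h2 q (Or.inl ⟨hq, ?_⟩)⟩
    rintro _ rfl
    exact hg
  · rintro ⟨h1, h2, h3⟩
    refine ⟨h1, ?_⟩
    rintro q (⟨hq, hg⟩ | rfl)
    · exact h3 q hq (hg _ rfl)
    · exact h2

/-- Orthogonal decompositions are unique. -/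
theorem IsOrthogonalDecomposition.unique (hD : D.HasGeneralComparability) {x' y' : V}
    (h : D.IsOrthogonalDecomposition g x y) (h' : D.IsOrthogonalDecomposition g x' y') :
    x = x' ∧ y = y' := by
  have key : ∀ x y x' y', D.IsOrthogonalDecomposition g x y →
      D.IsOrthogonalDecomposition g x' y' → x = x' := by
    obtain ⟨q, hq, hq1, hq2⟩ := hD g
    obtain ⟨hqP, hqg, hqc⟩ := mem_bicomm_iff.1 hq
    have : ∀ x y, D.IsOrthogonalDecomposition g x y → x = D.J q g := by
      intro x y h
      obtain ⟨p, hp, hpg, rfl, hy⟩ := h.mem_C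
      have hpq := hqc p hp hpg
      have hqp := mem_C_symm hqP hp hpq
      have hy' : D.J (u - p) g ≤ 0 := by rw [hy]; exact neg_nonpos.2 h.2.1
      -- Both cross terms vanish: in one order of the commuting compressions they are negative, in
      -- the other positive. Hence both positive parts equal `J p (J q g)`.
      have e1 : D.J p (D.J (u - q) g) = 0 := by
        refine le_antisymm (J_nonpos hp hq1) ?_
        rw [J_comm hp (D.compl_mem q hqP) (sub_mem_C (unit_mem_C hp) hqp)]
        exact D.positive _ (D.compl_mem q hqP) _ h.1
      have e2 : D.J q (D.J (u - p) g) = 0 := by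
        refine le_antisymm (J_nonpos hqP hy') ?_
        rw [J_comm hqP (D.compl_mem p hp) (sub_mem_C (unit_mem_C hqP) hpq)]
        exact D.positive _ (D.compl_mem p hp) _ hq2
      conv_lhs => rw [mem_C_iff.1 hqg, map_add, e1, add_zero, J_comm hp hqP hqp]
      conv_rhs => rw [mem_C_iff.1 hpg, map_add, e2, add_zero]
    intro x y x' y' h h'
    rw [this x y h, this x' y' h']
  have hx := key _ _ _ _ h h'
  refine ⟨hx, ?_⟩
  have h3 := h.2.2.1
  rw [h'.2.2.1, hx, sub_right_inj] at h3
  exact h3.symm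

theorem IsRickartStar.unique (h : D.IsRickartStar g r) (h' : D.IsRickartStar g s) : r = s :=
  le_antisymm ((h'.2 r h.1).2 ((h.2 r h.1).1 le_rfl)) ((h.2 s h'.1).2 ((h'.2 s h'.1).1 le_rfl))

theorem IsRickartStar.le_of_J_eq_zero (hu : IsOrderUnit u) (h : D.IsRickartStar x r)
    (h0 : 0 ≤ x) (hp : p ∈ D.P) (hx : D.J p x = 0) : p ≤ r :=
  (h.2 p hp).2 ⟨mem_C_of_J_eq_zero hu hp h0 hx, hx⟩

theorem IsRickartStar.J_eq_zero (h : D.IsRickartStar x r) : D.J r x = 0 :=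
  ((h.2 r h.1).1 le_rfl).2

/-- A projection which commutes with `x ≥ 0` commutes with `x^*`. -/
theorem IsRickartStar.mem_C (hu : IsOrderUnit u) (hR : D.IsRickart) (h : D.IsRickartStar x r)
    (h0 : 0 ≤ x) (hp : p ∈ D.P) (hx : x ∈ D.C p) : r ∈ D.C p := by
  obtain ⟨c, hc, -, hxc⟩ := hu.exists_abs_le x
  have hp' := D.compl_mem p hp
  have hr' := D.compl_mem r h.1
  -- Here `s` is the support of `J q x`; it lies below `q` and below the support `u - r` of `x`.
  -- Applied to `p` and to `u - p`, this yields two projections commuting with `p` whose sum is all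
  -- of `u - r`.
  have key : ∀ q ∈ D.P, D.J q x ≤ x → ∃ s ∈ D.P, s ≤ q ∧ D.J q x ≤ c • s ∧ s ≤ u - r := by
    intro q hq hqx
    have hqx0 := D.positive q hq x h0
    obtain ⟨t, ht⟩ := hR (D.J q x)
    refine ⟨u - t, D.compl_mem t ht.1, ?_, le_smul_compl ht.1 hc hqx0 (hqx.trans hxc)
      ht.J_eq_zero, ?_⟩
    · exact sub_le_comm.1 (ht.le_of_J_eq_zero hu hqx0 (D.compl_mem q hq)
        (J_J_of_le_compl hu (D.compl_mem q hq) hq (by simp)))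
    · refine sub_le_sub_left (ht.le_of_J_eq_zero hu hqx0 h.1 (le_antisymm ?_ ?_)) u
      · exact (J_mono h.1 hqx).trans_eq h.J_eq_zero
      · exact D.positive r h.1 _ hqx0
  have hxe := mem_C_iff.1 hx
  obtain ⟨s, hs, hsp, hxs, hsr⟩ := key p hp
    (by conv_rhs => rw [hxe]
        exact le_add_of_nonneg_right (D.positive _ hp' x h0))
  obtain ⟨t, ht, htp, hxt, htr⟩ := key (u - p) hp'
    (by conv_rhs => rw [hxe]
        exact le_add_of_nonneg_left (D.positive _ hp x h0))
  -- `J (u - r)` fixes `s` and `t`, and it maps `s + t ≤ u` below `u - r`.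
  have hst : s + t ≤ u - r := by
    have h1 := D.apply_of_le _ hr' s (nonneg_of_mem hs) hsr
    have h2 := D.apply_of_le _ hr' t (nonneg_of_mem ht) htr
    rw [← h1, ← h2, ← map_add]
    simpa using J_le_smul hr' (c := 1) (x := s + t)
      (by simpa using (add_le_add hsp htp).trans_eq (add_sub_cancel p u))
  have hstP := D.add_mem s hs t ht (hst.trans (le_unit_of_mem hr'))
  have hx2 : x ≤ c • (s + t) := by
    rw [smul_add, hxe]; exact add_le_add hxs hxt
  have hle : u - (s + t) ≤ r := h.le_of_J_eq_zero hu h0 (D.compl_mem _ hstP)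
    (LinearCompressionBase.J_eq_zero (c := c) (D.compl_mem _ hstP) h0 (by simpa using hx2))
  rw [le_antisymm (le_sub_comm.1 hst) hle]
  exact sub_mem_C (unit_mem_C hp) (add_mem_C (mem_C_of_le hp (nonneg_of_mem hs) hsp)
    (mem_C_compl.1 (mem_C_of_le hp' (nonneg_of_mem ht) htp)))

/-- The spectral resolution of `a`. -/
structure IsSpectralFamily (D : LinearCompressionBase u) (a : V) (e : ℝ → V) : Prop where
  mem : ∀ l, e l ∈ D.P
  mem_C : ∀ l, a ∈ D.C (e l)
  mono : Monotone e
  J_le : ∀ l, D.J (e l) (a - l • u) ≤ 0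
  le_J : ∀ l, 0 ≤ D.J (u - e l) (a - l • u)
  star : ∀ l, D.IsRickartStar (D.J (u - e l) (a - l • u)) (e l)

/-- A comparability projection `q` is not canonical. Taking `e = (J q g)^*` adds to `u - q` the part
of `q` on which `g` vanishes, so that `u - e` is exactly the support of the positive part; `e` stays
in the bicommutant by `IsRickartStar.mem_C`. -/
theorem exists_spectralProjection (hu : IsOrderUnit u) (hD : D.HasGeneralComparability)
    (hR : D.IsRickart) (g : V) : ∃ e ∈ D.bicomm g, D.J e g ≤ 0 ∧ 0 ≤ D.J (u - e) g ∧
      D.IsRickartStar (D.J (u - e) g) e := by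
  obtain ⟨q, hq, hq1, hq2⟩ := hD g
  obtain ⟨hqP, hqg, hqc⟩ := mem_bicomm_iff.1 hq
  have hq' := D.compl_mem q hqP
  obtain ⟨e, he⟩ := hR (D.J q g)
  have heP := he.1
  have he' := D.compl_mem e heP
  have h0 : D.J e (D.J q g) = 0 := ((he.2 e heP).1 le_rfl).2
  have hle : ∀ p ∈ D.P, D.J p (D.J q g) = 0 → p ≤ e := fun p hp h =>
    (he.2 p hp).2 ⟨mem_C_of_J_eq_zero hu hp hq2 h, h⟩
  have hqe : u - q ≤ e := hle _ hq' (J_J_of_le_compl hu hq' hqP (by simp))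
  have h1 : D.J (u - e) (D.J q g) = D.J q g := by
    rw [J_compl_of_mem_C (mem_C_of_J_eq_zero hu heP hq2 h0), h0, sub_zero]
  have h2 : D.J (u - e) (D.J (u - q) g) = 0 :=
    J_J_of_le_compl hu he' hq' (by simpa using hqe)
  have h3 : D.J e (D.J (u - q) g) = D.J (u - q) g := (J_of_le hq' heP hqe g).1
  have h4 : D.J (u - e) g = D.J q g := by
    conv_lhs => rw [mem_C_iff.1 hqg, map_add, h1, h2, add_zero]
  have h5 : D.J e g = D.J (u - q) g := by
    conv_lhs => rw [mem_C_iff.1 hqg, map_add, h0, h3, zero_add]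
  refine ⟨e, mem_bicomm_iff.2 ⟨heP, ?_, ?_⟩, by rwa [h5], by rwa [h4], by rwa [h4]⟩
  · rw [mem_C_iff, h4, h5, add_comm]; exact hqg
  · intro p hp hg
    have hqp : q ∈ D.C p := mem_C_symm hqP hp (hqc p hp hg)
    exact mem_C_symm hp heP (he.mem_C hu hR hq2 hp (mem_C_J hp hqP hqp hg))

end LinearCompressionBase

/-! ### Spectral families: monotonicity, right continuity, slices, integral -/

namespace LinearCompressionBase

variable {V : Type*} [AddCommGroup V] [PartialOrder V] [IsOrderedAddMonoid V] [Module ℝ V]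
    [IsOrderedModule ℝ V] {u : V} {D : LinearCompressionBase u}

theorem sub_smul_unit_mem_C_iff {p a : V} (hp : p ∈ D.P) (l : ℝ) :
    a - l • u ∈ D.C p ↔ a ∈ D.C p := by
  refine ⟨fun h => ?_, fun h => sub_mem_C h (smul_mem_C l (unit_mem_C hp))⟩
  simpa using add_mem_C h (smul_mem_C l (unit_mem_C hp))

theorem exists_isSpectralFamily (hu : IsOrderUnit u) (hD : D.HasGeneralComparability)
    (hR : D.IsRickart) (a : V) : ∃ e, D.IsSpectralFamily a e := by
  choose e he h1 h2 h3 using fun l : ℝ => exists_spectralProjection hu hD hR (a - l • u)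
  have hm := fun l => mem_bicomm_iff.1 (he l)
  have hC : ∀ l, a ∈ D.C (e l) := fun l => (sub_smul_unit_mem_C_iff (hm l).1 l).1 (hm l).2.1
  refine ⟨e, fun l => (hm l).1, hC, fun l m hlm => ?_, h1, h2, h3⟩
  have hcomm : e m ∈ D.C (e l) :=
    (hm l).2.2 _ (hm m).1 ((sub_smul_unit_mem_C_iff (hm m).1 l).2 (hC m))
  -- On `e l` the vector `a - m • u` is below `a - l • u`, hence negative; so `J (e l)` kills the
  -- positive part at `m`, and maximality of `e m` applies.
  refine (h3 m).le_of_J_eq_zero hu (h2 m) (hm l).1 (le_antisymm ?_ ?_)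
  · rw [J_comm (hm l).1 (D.compl_mem _ (hm m).1) (sub_mem_C (unit_mem_C (hm l).1) hcomm)]
    refine J_nonpos (D.compl_mem _ (hm m).1) ((J_mono (hm l).1 ?_).trans (h1 l))
    exact sub_le_sub_left (smul_le_smul_of_nonneg_right hlm hu.1) a
  · exact D.positive _ (hm l).1 _ (h2 m)

namespace IsSpectralFamily

variable {a : V} {e : ℝ → V}

theorem eq_zero (h : D.IsSpectralFamily a e) (ha : 0 ≤ a) {l : ℝ} (hl : l < 0) : e l = 0 := by
  refine le_antisymm ?_ (nonneg_of_mem (h.mem l))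
  have h1 := h.J_le l
  rw [map_sub, map_smul, D.focus _ (h.mem l), sub_nonpos] at h1
  have h2 := (D.positive _ (h.mem l) a ha).trans h1
  have h3 := smul_nonneg (neg_nonneg.2 (inv_nonpos.2 hl.le)) h2
  rw [smul_smul, neg_mul, inv_mul_cancel₀ hl.ne, neg_smul, one_smul] at h3
  exact neg_nonneg.1 h3

theorem eq_unit (h : D.IsSpectralFamily a e) (hu : IsOrderUnit u) (ha : a ≤ u) {l : ℝ}
    (hl : 1 ≤ l) : e l = u := by
  refine le_antisymm (le_unit_of_mem (h.mem l)) ?_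
  refine (h.star l).le_of_J_eq_zero hu (h.le_J l) D.unit_mem ?_
  rw [J_unit hu]
  refine le_antisymm (J_nonpos (D.compl_mem _ (h.mem l)) (sub_nonpos.2 (ha.trans ?_))) (h.le_J l)
  exact le_smul_of_one_le_left hu.1 hl

theorem isSpectralProjection_iff (h : D.IsSpectralFamily a e) (hD : D.HasGeneralComparability)
    (l : ℝ) (q : V) : D.IsSpectralProjection a l q ↔ q = e l := by
  have hC := sub_mem_C (h.mem_C l) (smul_mem_C l (unit_mem_C (h.mem l)))
  have hdec := IsOrthogonalDecomposition.of_mem (D.compl_mem _ (h.mem l)) (mem_C_compl.2 hC)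
    (h.le_J l) (by rw [sub_sub_cancel]; exact h.J_le l)
  constructor
  · rintro ⟨x, y, hxy, hq⟩
    rw [(hxy.unique hD hdec).1] at hq
    exact hq.unique (h.star l)
  · rintro rfl
    exact ⟨_, _, hdec, h.star l⟩

theorem sub_mem (h : D.IsSpectralFamily a e) {l m : ℝ} (hlm : l ≤ m) : e m - e l ∈ D.P :=
  LinearCompressionBase.sub_mem (h.mem l) (h.mem m) (h.mono hlm)

theorem sub_le_compl (h : D.IsSpectralFamily a e) (l m : ℝ) : e m - e l ≤ u - e l :=
  sub_le_sub_right (le_unit_of_mem (h.mem m)) _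

theorem sub_le (h : D.IsSpectralFamily a e) (l m : ℝ) : e m - e l ≤ e m :=
  sub_le_self _ (nonneg_of_mem (h.mem l))

theorem mem_C_sub (h : D.IsSpectralFamily a e) {l m : ℝ} (hlm : l ≤ m) : a ∈ D.C (e m - e l) :=
  LinearCompressionBase.mem_C_sub (h.mem l) (h.mem m) (h.mono hlm) (h.mem_C l) (h.mem_C m)

theorem J_sub_nonneg (h : D.IsSpectralFamily a e) {l m : ℝ} (hlm : l ≤ m) :
    0 ≤ D.J (e m - e l) (a - l • u) := by
  rw [← (J_of_le (h.sub_mem hlm) (D.compl_mem _ (h.mem l)) (h.sub_le_compl l m) _).2]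
  exact D.positive _ (h.sub_mem hlm) _ (h.le_J l)

theorem J_sub_nonpos (h : D.IsSpectralFamily a e) {l m : ℝ} (hlm : l ≤ m) :
    D.J (e m - e l) (a - m • u) ≤ 0 := by
  rw [← (J_of_le (h.sub_mem hlm) (h.mem m) (h.sub_le l m) _).2]
  exact J_nonpos (h.sub_mem hlm) (h.J_le m)

theorem smul_le_J_sub (h : D.IsSpectralFamily a e) {l m : ℝ} (hlm : l ≤ m) :
    l • (e m - e l) ≤ D.J (e m - e l) a := by
  have := h.J_sub_nonneg hlm
  rwa [map_sub, map_smul, D.focus _ (h.sub_mem hlm), sub_nonneg] at this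

theorem J_sub_le_smul (h : D.IsSpectralFamily a e) {l m : ℝ} (hlm : l ≤ m) :
    D.J (e m - e l) a ≤ m • (e m - e l) := by
  have := h.J_sub_nonpos hlm
  rwa [map_sub, map_smul, D.focus _ (h.sub_mem hlm), sub_nonpos] at this

/-- Right continuity. -/
theorem le_of_forall_pos (h : D.IsSpectralFamily a e) (hu : IsOrderUnitSpace u)
    (hR : D.IsRickart) {l : ℝ} {x : V} (h0 : 0 ≤ x)
    (hx : ∀ ε : ℝ, 0 < ε → ∃ m, l ≤ m ∧ m ≤ l + ε ∧ x ≤ e m) : x ≤ e l := by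
  -- `u - r` is the support of `x`. It also lies below each of these `e m`, so it may replace `x`,
  -- and maximality of `e l` can be used.
  obtain ⟨r, hr⟩ := hR x
  have hp := D.compl_mem r hr.1
  obtain ⟨m₀, -, -, hm₀⟩ := hx 1 one_pos
  have hxu : x ≤ u := hm₀.trans (le_unit_of_mem (h.mem m₀))
  have hxr : x ≤ u - r := by
    simpa using le_smul_compl hr.1 one_pos h0 (by simpa using hxu) hr.J_eq_zero
  refine hxr.trans ((h.star l).le_of_J_eq_zero hu.1 (h.le_J l) hp ?_)
  refine le_antisymm (hu.2 _ u fun n => ?_) (D.positive _ hp _ (h.le_J l))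
  have hn : (0 : ℝ) < n + 1 := by positivity
  obtain ⟨m, hlm, hm, hxm⟩ := hx (n + 1 : ℝ)⁻¹ (by positivity)
  have hm' := D.compl_mem _ (h.mem m)
  have hrm : u - r ≤ e m := by
    rw [sub_le_comm]
    exact hr.le_of_J_eq_zero hu.1 h0 hm'
      (J_eq_zero (c := 1) hm' h0 (by simpa using hxm))
  -- Being below `e m`, the projection `u - r` sees only the slice `e m - e l`, where `a - l • u` is
  -- at most `m - l ≤ 1 / (n + 1)`. Hence `n` times the vector stays below `u`.
  have e1 : D.J (u - r) (D.J (u - e l) (a - l • u)) =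
      D.J (u - r) (D.J (e m - e l) (a - l • u)) := by
    have hC : a - l • u ∈ D.C (u - e m) := mem_C_compl.2
      ((sub_smul_unit_mem_C_iff (h.mem m) l).2 (h.mem_C m))
    have hs : (e m - e l) + (u - e m) = u - e l := by abel
    have := J_add (h.sub_mem hlm) hm'
      (by rw [hs]; exact sub_le_self _ (nonneg_of_mem (h.mem l))) hC
    rw [hs] at this
    rw [this, map_add, J_J_of_le_compl hu.1 hp hm' (sub_le_sub_left hrm u), add_zero]
  rw [e1]
  have e2 : D.J (e m - e l) (a - l • u) ≤ (n + 1 : ℝ)⁻¹ • u := by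
    have h1 := h.J_sub_le_smul hlm
    rw [map_sub, map_smul, D.focus _ (h.sub_mem hlm)]
    calc _ ≤ m • (e m - e l) - l • (e m - e l) := sub_le_sub_right h1 _
      _ = (m - l) • (e m - e l) := (sub_smul _ _ _).symm
      _ ≤ (n + 1 : ℝ)⁻¹ • (e m - e l) :=
        smul_le_smul_of_nonneg_right (by linarith) (nonneg_of_mem (h.sub_mem hlm))
      _ ≤ _ := smul_le_smul_of_nonneg_left (le_unit_of_mem (h.sub_mem hlm)) (by positivity)
  have e3 := J_le_smul hp e2
  have e4 : 0 ≤ D.J (u - r) (D.J (e m - e l) (a - l • u)) :=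
    D.positive _ hp _ (h.J_sub_nonneg hlm)
  rw [← Nat.cast_smul_eq_nsmul ℝ]
  calc _ ≤ ((n : ℝ) + 1) • D.J (u - r) (D.J (e m - e l) (a - l • u)) :=
        smul_le_smul_of_nonneg_right (by linarith) e4
    _ ≤ ((n : ℝ) + 1) • ((n + 1 : ℝ)⁻¹ • (u - r)) := smul_le_smul_of_nonneg_left e3 hn.le
    _ = u - r := by rw [smul_smul, mul_inv_cancel₀ hn.ne', one_smul]
    _ ≤ u := le_unit_of_mem hp

theorem J_compl_zero (h : D.IsSpectralFamily a e) (ha : 0 ≤ a) : D.J (u - e 0) a = a := by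
  have h1 : D.J (e 0) a = 0 :=
    le_antisymm (by simpa using h.J_le 0) (D.positive _ (h.mem 0) a ha)
  rw [J_compl_of_mem_C (h.mem_C 0), h1, sub_zero]

/-- The support of `a - l • u` on the slice is the whole slice: a subprojection on which it vanished
would lie below `e l` by maximality, yet it is orthogonal to `e l`. This gives the projection cover
in the splitting step. -/
theorem isRickartStar_sub (h : D.IsSpectralFamily a e) (hu : IsOrderUnit u) (hR : D.IsRickart)
    {l m t : ℝ}
    (hlm : l ≤ m) (ht : 0 < t) :
    D.IsRickartStar (D.J (e m - e l) (t • (a - l • u))) (u - (e m - e l)) := by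
  have hd := h.sub_mem hlm
  have hd' := D.compl_mem _ hd
  refine ⟨hd', fun p hp => ?_⟩
  have h0 : 0 ≤ D.J (e m - e l) (t • (a - l • u)) := by
    rw [map_smul]; exact smul_nonneg ht.le (h.J_sub_nonneg hlm)
  constructor
  · intro hpd
    have := J_J_of_le_compl hu hp hd (x := t • (a - l • u)) (le_sub_comm.1 hpd)
    exact ⟨mem_C_of_J_eq_zero hu hp h0 this, this⟩
  · rintro ⟨-, h1⟩
    rw [map_smul, map_smul, smul_eq_zero_iff_right ht.ne'] at h1
    have h0 := h.J_sub_nonneg hlm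
    have hl' := D.compl_mem _ (h.mem l)
    have hm' := D.compl_mem _ (h.mem m)
    obtain ⟨r, hr⟩ := hR (D.J (e m - e l) (a - l • u))
    refine (hr.le_of_J_eq_zero hu h0 hp h1).trans ?_
    have hdr := hr.le_of_J_eq_zero hu h0 hd' (J_J_of_le_compl hu hd' hd (by simp))
    -- the part `q` of `e m - e l` outside of the support vanishes
    have hq := LinearCompressionBase.sub_mem hd' hr.1 hdr
    obtain ⟨q, hqe⟩ : ∃ q, q = r - (u - (e m - e l)) := ⟨_, rfl⟩
    rw [← hqe] at hq
    have hqr : q ≤ r := hqe ▸ sub_le_self _ (nonneg_of_mem hd')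
    have hqd : q ≤ e m - e l := by
      rw [hqe, sub_sub_eq_add_sub, sub_le_iff_le_add, add_comm]
      exact add_le_add_right (le_unit_of_mem hr.1) _
    have e1 : D.J q (D.J (e m - e l) (a - l • u)) = 0 := by
      rw [← (J_of_le hq hr.1 hqr _).2, hr.J_eq_zero, map_zero]
    have e2 : D.J q (D.J (u - e m) (a - l • u)) = 0 := by
      refine J_J_of_le_compl hu hq hm' (sub_le_sub_left (hqd.trans (h.sub_le l m)) u)
    have hC : a - l • u ∈ D.C (u - e m) := mem_C_compl.2
      ((sub_smul_unit_mem_C_iff (h.mem m) l).2 (h.mem_C m))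
    have hs : (e m - e l) + (u - e m) = u - e l := by abel
    have hadd := J_add hd hm' (by rw [hs]; exact sub_le_self _ (nonneg_of_mem (h.mem l))) hC
    rw [hs] at hadd
    have hql : q ≤ e l := (h.star l).le_of_J_eq_zero hu (h.le_J l) hq (by
      rw [hadd, map_add, e1, e2, add_zero])
    have hq0 : q = 0 := by
      have h2 := D.apply_of_le _ (h.mem l) q (nonneg_of_mem hq) hql
      have h3 := LinearCompressionBase.J_eq_zero (c := 1) (h.mem l) (nonneg_of_mem hq)
        (by simpa using hqd.trans (h.sub_le_compl l m))
      rw [← h2, h3]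
    rw [hq0] at hqe
    exact (sub_eq_zero.1 hqe.symm).le

/-- The vector decomposed is `c - c'` in the splitting step. As `c` lives below `e m - e k`, its
orthosupplement contains everything outside that slice, and this surplus goes into the negative
part. -/
theorem isOrthogonalDecomposition_step (h : D.IsSpectralFamily a e)
    {k l m : ℝ} {w : V} (hkl : k ≤ l) (hlm : l ≤ m) (hC : ∀ p ∈ D.P, a ∈ D.C p → w ∈ D.C p)
    (h0 : 0 ≤ D.J (e m - e l) w) (h1 : D.J (e l - e k) w ≤ 0) :
    D.IsOrthogonalDecomposition (D.J (e m - e k) w - (u - (e m - e k)))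
      (D.J (e m - e l) w) ((u - (e m - e k)) - D.J (e l - e k) w) := by
  have hkm := hkl.trans hlm
  have hd := h.sub_mem hlm
  have hd₁ := h.sub_mem hkl
  have hv := h.sub_mem hkm
  have hdv : e m - e l ≤ e m - e k := sub_le_sub_left (h.mono hkl) _
  have hs : (e m - e l) + (e l - e k) = e m - e k := by abel
  have hle : (e m - e l) + (e l - e k) ≤ u := by rw [hs]; exact le_unit_of_mem hv
  have hadd := J_add hd hd₁ hle (hC _ hd₁ (h.mem_C_sub hkl))
  rw [hs] at hadd
  have e1 : D.J (e m - e l) (D.J (e m - e k) w - (u - (e m - e k))) = D.J (e m - e l) w := by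
    rw [map_sub, (J_of_le hd hv hdv w).2, map_sub, D.focus _ hd]
    have := (J_of_le hd hv hdv u).2
    rw [D.focus _ hd, D.focus _ hv] at this
    rw [this]; simp
  have hdC : e m - e k ∈ D.C (e m - e l) :=
    mem_C_symm hv hd (mem_C_of_le hv (nonneg_of_mem hd) hdv)
  have hg : D.J (e m - e k) w - (u - (e m - e k)) ∈ D.C (e m - e l) :=
    sub_mem_C (mem_C_J hd hv hdC (hC _ hd (h.mem_C_sub hlm))) (sub_mem_C (unit_mem_C hd) hdC)
  have e2 := J_compl_of_mem_C hg
  rw [e1, hadd] at e2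
  have h2 : 0 ≤ u - (e m - e k) := sub_nonneg.2 (le_unit_of_mem hv)
  refine ⟨h0, sub_nonneg.2 (h1.trans h2), by rw [hadd]; abel, e m - e l, hd, e1, ?_⟩
  rw [hadd, e2]; abel

theorem J_sum_sub (h : D.IsSpectralFamily a e) {τ : ℕ → ℝ} {N : ℕ}
    (hτ : ∀ j < N, τ j ≤ τ (j + 1)) :
    ∑ j ∈ Finset.range N, D.J (e (τ (j + 1)) - e (τ j)) a = D.J (e (τ N)) a - D.J (e (τ 0)) a := by
  rw [← Finset.sum_range_sub (fun j => D.J (e (τ j)) a)]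
  refine Finset.sum_congr rfl fun j hj => ?_
  have := hτ j (Finset.mem_range.1 hj)
  exact J_sub (h.mem _) (h.mem _) (h.mono this) (h.mem_C _)

theorem hasRiemannStieltjesIntegral (h : D.IsSpectralFamily a e) (hu : IsOrderUnit u)
    (h0 : 0 ≤ a) (h1 : a ≤ u) : HasRiemannStieltjesIntegral u (fun l => l) e 0 1 a := by
  intro ε hε
  refine ⟨ε / 2, by positivity, fun N τ ξ hτ0 hτN hτ => ?_⟩
  have hmono : ∀ j < N, τ j ≤ τ (j + 1) := fun j hj => (hτ j hj).1.trans (hτ j hj).2.1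
  -- The compressed pieces telescope to `J (e 1) a - J (e 0) a`, where `J (e 1)` is the identity and
  -- `J (e 0) a = 0`.
  have ha : a = ∑ j ∈ Finset.range N, D.J (e (τ (j + 1)) - e (τ j)) a := by
    rw [h.J_sum_sub hmono, hτ0, hτN, h.eq_unit hu h1 le_rfl, J_unit hu,
      ← J_compl_of_mem_C (h.mem_C 0), h.J_compl_zero h0]
  -- The slice errors are each at most `ε / 2` times the slice, and the slices sum to at most `u`,
  -- so the total bound does not depend on `N`.
  have hsum : ∑ j ∈ Finset.range N, (ε / 2) • (e (τ (j + 1)) - e (τ j)) ≤ (ε / 2) • u := by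
    rw [← Finset.smul_sum, Finset.sum_range_sub (fun j => e (τ j))]
    refine smul_le_smul_of_nonneg_left ?_ (by positivity)
    exact (sub_le_self _ (nonneg_of_mem (h.mem _))).trans (le_unit_of_mem (h.mem _))
  have hdiff : a - ∑ j ∈ Finset.range N, ξ j • (e (τ (j + 1)) - e (τ j)) =
      ∑ j ∈ Finset.range N, (D.J (e (τ (j + 1)) - e (τ j)) a -
        ξ j • (e (τ (j + 1)) - e (τ j))) := by
    rw [Finset.sum_sub_distrib, ← ha]
  refine lt_of_le_of_lt (csInf_le ⟨0, fun r hr => hr.1⟩ ⟨by positivity, ?_, ?_⟩)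
    (half_lt_self hε)
  · rw [neg_le, hdiff, ← Finset.sum_neg_distrib]
    refine (Finset.sum_le_sum fun j hj => ?_).trans hsum
    obtain ⟨h2, h3, h4⟩ := hτ j (Finset.mem_range.1 hj)
    have hd := nonneg_of_mem (h.sub_mem (h2.trans h3))
    rw [neg_sub]
    refine (sub_le_sub_left (h.smul_le_J_sub (h2.trans h3)) _).trans ?_
    rw [← sub_smul]
    exact smul_le_smul_of_nonneg_right (by linarith) hd
  · rw [hdiff]
    refine (Finset.sum_le_sum fun j hj => ?_).trans hsum
    obtain ⟨h2, h3, h4⟩ := hτ j (Finset.mem_range.1 hj)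
    have hd := nonneg_of_mem (h.sub_mem (h2.trans h3))
    refine (sub_le_sub_right (h.J_sub_le_smul (h2.trans h3)) _).trans ?_
    rw [← sub_smul]
    exact smul_le_smul_of_nonneg_right (by linarith) hd

end IsSpectralFamily

end LinearCompressionBase

/-! ### Archimedeanity of V and extension of the compressions -/

section Extension

variable {E : Type*} [ConvexEffectAlgebra E]
    {V : Type*} [AddCommGroup V] [PartialOrder V] [IsOrderedAddMonoid V] [Module ℝ V]
    [IsOrderedModule ℝ V] {u : V} {i : E → V}

theorem CompressionBase.mem_C_iff (hV : IsUniversalVectorSpace u i) (B : CompressionBase E)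
    {p a : E} : a ∈ B.C p ↔ i (B.J p a) + i (B.J (orth p) a) = i a :=
  hV.oplus_eq_iff

namespace IsUniversalVectorSpace

theorem exists_extension (hV : IsUniversalVectorSpace u i) (B : CompressionBase E) {p : E}
    (hp : p ∈ B.P) : ∃! f : V →+ V, ∀ a, f (i a) = i (B.J p a) := by
  refine hV.universal V (fun a => i (B.J p a)) fun a b hab => ?_
  have := (B.isCompression p hp).additive a b hab
  rw [this.2, hV.map_oplus _ _ this.1]

theorem map_J_orth (hV : IsUniversalVectorSpace u i) (B : CompressionBase E) {p : E}
    (hp : p ∈ B.P) (a : E) : i (B.J p (orth a)) = i p - i (B.J p a) := by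
  have h := (B.isCompression p hp).additive a (orth a) (perp_orth a)
  rw [oplus_orth, B.focus p hp] at h
  rw [eq_sub_iff_add_eq', ← hV.map_oplus _ _ h.1, ← h.2]

theorem orth_mem_C_iff (hV : IsUniversalVectorSpace u i) (B : CompressionBase E) {p : E}
    (hp : p ∈ B.P) {a : E} : orth a ∈ B.C p ↔ a ∈ B.C p := by
  rw [B.mem_C_iff hV, B.mem_C_iff hV, hV.map_J_orth B hp,
    hV.map_J_orth B (B.isSub.orth_mem p hp), hV.map_orth, hV.map_orth]
  constructor <;> intro h
  · have : i (B.J p a) + i (B.J (orth p) a) =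
      u - (i p - i (B.J p a) + (u - i p - i (B.J (orth p) a))) := by abel
    rw [this, h]; abel
  · rw [← h]; abel

theorem map_J_le (hV : IsUniversalVectorSpace u i) (B : CompressionBase E) {p : E}
    (hp : p ∈ B.P) (a : E) : i (B.J p a) ≤ i p := by
  rw [← sub_nonneg, ← hV.map_J_orth B hp]
  exact hV.nonneg _

/-- `a` and `orth a` commute with the same projections, so `q` in the bicommutant of `a` commutes
with `p` in that of `orth a`. Commutation provides the Mackey decomposition with common part `J p
q`. -/
theorem commutes_orth (hV : IsUniversalVectorSpace u i) (B : CompressionBase E) (a : E) :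
    B.Commutes (orth a) a := by
  intro p hp q hq
  have hqa : a ∈ B.C q := hq.2 a (Or.inr rfl)
  have hqp : q ∈ B.C p :=
    hp.2 q (Or.inl ⟨hq.1, by rintro _ rfl; exact (hV.orth_mem_C_iff B hq.1).2 hqa⟩)
  have h := (B.mem_C_iff hV).1 hqp
  have hle := hV.map_J_le B hp.1 q
  have hle' := hV.map_J_le B (B.isSub.orth_mem p hp.1) q
  rw [hV.map_orth] at hle'
  refine hV.mackeyCompat_iff.2 ⟨i p - i (B.J p q), i (B.J (orth p) q), i (B.J p q),
    sub_nonneg.2 hle, hV.nonneg _, hV.nonneg _, ?_, by abel, by rw [← h, add_comm]⟩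
  have : i p + i (B.J (orth p) q) ≤ u := by rw [add_comm]; exact le_sub_iff_add_le.1 hle'
  convert this using 1; abel

/-- Linearity of `f` is not yet known, so a positive vector is written as an integer multiple of an
element of the unit interval. -/
theorem extension_nonneg (hV : IsUniversalVectorSpace u i) {J : E → E} (f : V →+ V)
    (hf : ∀ a, f (i a) = i (J a)) (x : V) (hx : 0 ≤ x) : 0 ≤ f x := by
  obtain ⟨n, hn⟩ := hV.orderUnit.2 x
  rcases Nat.eq_zero_or_pos n with rfl | hn0
  · rw [zero_smul] at hn
    rw [le_antisymm hn hx, _root_.map_zero]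
  · have hn0 : (0 : ℝ) < n := by exact_mod_cast hn0
    rw [← Nat.cast_smul_eq_nsmul ℝ] at hn
    obtain ⟨a, ha⟩ := hV.exists_eq (x := (n : ℝ)⁻¹ • x) (smul_nonneg (by positivity) hx)
      ((inv_smul_le_iff_of_pos hn0).2 hn)
    have : x = n • i a := by
      rw [ha, ← Nat.cast_smul_eq_nsmul ℝ, smul_smul, mul_inv_cancel₀ hn0.ne', one_smul]
    rw [this, map_nsmul, hf]
    exact nsmul_nonneg (hV.nonneg _) n

/-- A spectral archimedean convex effect algebra has an archimedean universal group. -/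
theorem isOrderUnitSpace (hV : IsUniversalVectorSpace u i) (hE : IsArchimedean E)
    (B : CompressionBase E) (hB : B.IsSpectral) : IsOrderUnitSpace u := by
  have hzero : ∀ x : V, 0 ≤ x → (∀ n : ℕ, n • x ≤ u) → x = 0 := by
    intro x hx h
    obtain ⟨a, rfl⟩ := hV.exists_eq hx (by simpa using h 1)
    rw [hE a fun n => ?_, hV.map_zero]
    obtain ⟨s, hs⟩ := hV.exists_eq (nsmul_nonneg hx n) (h n)
    exact ⟨s, hV.oSumsTo_iff.2 (by simp [hs, hV.map_zero])⟩
  -- Compressing by a comparability projection `p` isolates the positive part, an element of E all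
  -- of whose multiples are below `u`, hence zero. What remains is the negative part.
  have hone : ∀ (k : ℕ) (a : E), (∀ n : ℕ, n • (i a - i (orth a)) ≤ k • u) →
      i a - i (orth a) ≤ 0 := by
    intro k a h
    obtain ⟨p, hp, h1, h2⟩ := hB.1.2 _ _ (hV.commutes_orth B a)
    have hpP := hp.1
    have hpa : a ∈ B.C p := hp.2 a (Or.inr (by simp))
    obtain ⟨f, hf, -⟩ := hV.exists_extension B hpP
    rw [hV.le_iff] at h1 h2
    have hx : i (B.J p a) - i (B.J p (orth a)) = 0 := by
      refine hzero _ (sub_nonneg.2 h1) fun n => ?_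
      -- The bound is used at `(k + 1) * n`, so that dividing by `k + 1` brings the bound `k • i p`
      -- down to `i p`.
      have h3 := hV.extension_nonneg f hf _ (sub_nonneg.2 (h ((k + 1) * n)))
      rw [map_sub, map_nsmul, map_nsmul, map_sub, hf, hf, sub_nonneg, mul_smul] at h3
      have hfu : f u = i p := by rw [← hV.map_one, hf, B.focus p hpP]
      rw [hfu] at h3
      have h4 : (k + 1) • n • (i (B.J p a) - i (B.J p (orth a))) ≤ (k + 1) • i p :=
        h3.trans (nsmul_le_nsmul_left (hV.nonneg p) (Nat.le_succ k))
      rw [← Nat.cast_smul_eq_nsmul ℝ (k + 1), ← Nat.cast_smul_eq_nsmul ℝ (k + 1), ← sub_nonneg,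
        ← smul_sub] at h4
      have h5 := smul_nonneg (inv_nonneg.2 (Nat.cast_nonneg (k + 1) : (0 : ℝ) ≤ _)) h4
      rw [smul_smul, inv_mul_cancel₀ (by positivity), one_smul, sub_nonneg] at h5
      exact h5.trans (hV.le_unit p)
    have h5 := (B.mem_C_iff hV).1 hpa
    have h6 := (B.mem_C_iff hV).1 ((hV.orth_mem_C_iff B hpP).2 hpa)
    rw [← h5, ← h6, sub_eq_zero.1 hx, add_sub_add_left_eq_sub]
    exact sub_nonpos.2 h2
  refine ⟨hV.orderUnit, fun x y h => ?_⟩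
  obtain ⟨k, hk⟩ := hV.orderUnit.2 y
  obtain ⟨r, a, hr, rfl⟩ := hV.exists_sub_orth x
  have hpos : 0 < r⁻¹ := inv_pos.2 hr
  obtain ⟨k', hk'⟩ := exists_nat_ge (r⁻¹ * k)
  have := hone k' a fun n => by
    have h1 := smul_le_smul_of_nonneg_left ((h n).trans hk) hpos.le
    rw [smul_comm r⁻¹ n, smul_smul, inv_mul_cancel₀ hr.ne', one_smul,
      ← Nat.cast_smul_eq_nsmul ℝ k, smul_smul] at h1
    refine h1.trans ?_
    rw [← Nat.cast_smul_eq_nsmul ℝ k']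
    exact smul_le_smul_of_nonneg_right hk' hV.orderUnit.1
  exact smul_nonpos_of_nonneg_of_nonpos hr.le this

theorem isStronglyArchimedean (hV : IsUniversalVectorSpace u i) (hu : IsOrderUnitSpace u) :
    IsStronglyArchimedean E := by
  intro a b c h
  rw [hV.le_iff, ← sub_nonpos]
  refine hu.2 _ (i c) fun n => ?_
  rcases Nat.eq_zero_or_pos n with rfl | hn
  · simpa using hV.nonneg c
  · obtain ⟨h1, h2⟩ := h n hn
    have hn' : (0 : ℝ) < n := by exact_mod_cast hn
    rw [hV.le_iff, hV.map_oplus _ _ h1, hV.map_cmul _ _ ⟨by positivity, by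
      rw [div_le_one hn']; exact_mod_cast hn⟩, ← sub_le_iff_le_add', one_div,
      le_inv_smul_iff_of_pos hn', Nat.cast_smul_eq_nsmul] at h2
    exact h2

theorem exists_linearCompressionBase (hV : IsUniversalVectorSpace u i) (hu : IsOrderUnitSpace u)
    (B : CompressionBase E) : ∃ D : LinearCompressionBase u, D.IsUniqueExtension i B := by
  -- Off the image of `B.P` the map is 0; these values are never used.
  have hex : ∀ v : V, ∃ L : V →ₗ[ℝ] V, ∀ p ∈ B.P, i p = v → ∀ a, L (i a) = i (B.J p a) := by
    intro v
    by_cases h : ∃ p ∈ B.P, i p = v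
    · obtain ⟨p, hp, rfl⟩ := h
      obtain ⟨f, hf, -⟩ := hV.exists_extension B hp
      refine ⟨{ f with map_smul' := hu.map_smul_of_nonneg f (hV.extension_nonneg f hf) }, ?_⟩
      intro q _ hqp a
      rw [hV.injective hqp]
      exact hf a
    · exact ⟨0, fun p hp hpv => (h ⟨p, hp, hpv⟩).elim⟩
  choose L hL using hex
  have hL' : ∀ p ∈ B.P, ∀ a, L (i p) (i a) = i (B.J p a) := fun p hp => hL _ p hp rfl
  have huniq : ∀ p ∈ B.P, ∀ f : V →+ V, (∀ a, f (i a) = i (B.J p a)) → ∀ x, f x = L (i p) x := by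
    intro p hp f hf x
    have := (hV.exists_extension B hp).unique hf (y₂ := (L (i p)).toAddMonoidHom) (hL' p hp)
    rw [this]; rfl
  let D : LinearCompressionBase u :=
    { P := i '' B.P
      J := L
      subset := by
        rintro _ ⟨p, -, rfl⟩
        exact ⟨hV.nonneg p, hV.le_unit p⟩
      unit_mem := ⟨1, B.isSub.one_mem, hV.map_one⟩
      compl_mem := by
        rintro _ ⟨p, hp, rfl⟩
        exact ⟨orth p, B.isSub.orth_mem p hp, hV.map_orth p⟩
      add_mem := by
        rintro _ ⟨p, hp, rfl⟩ _ ⟨q, hq, rfl⟩ h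
        have hpq := (hV.perp_iff p q).2 h
        exact ⟨oplus p q, B.isSub.oplus_mem p hp q hq hpq, hV.map_oplus p q hpq⟩
      positive := by
        rintro _ ⟨p, hp, rfl⟩ x hx
        exact hV.extension_nonneg (L (i p)).toAddMonoidHom (hL' p hp) x hx
      focus := by
        rintro _ ⟨p, hp, rfl⟩
        rw [← hV.map_one, hL' p hp, B.focus p hp]
      apply_of_le := by
        rintro _ ⟨p, hp, rfl⟩ x hx hxp
        obtain ⟨a, rfl⟩ := hV.exists_eq hx (hxp.trans (hV.le_unit p))
        rw [hL' p hp, (B.isCompression p hp).apply_of_le a]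
        rwa [B.focus p hp, hV.le_iff]
      apply_eq_zero_iff := by
        rintro _ ⟨p, hp, rfl⟩ x hx hxu
        obtain ⟨a, rfl⟩ := hV.exists_eq hx hxu
        have := (B.isCompression p hp).apply_eq_zero_iff a
        rw [B.focus p hp, hV.le_iff, hV.map_orth] at this
        rw [hL' p hp, ← this, ← hV.map_zero, hV.injective.eq_iff]
      comp := by
        rintro _ ⟨p, hp, rfl⟩ _ ⟨q, hq, rfl⟩ ⟨x, y, z, hx, hy, hz, hs, h1, h2⟩
        obtain ⟨r, hr, h⟩ := B.comp p hp q hq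
          (hV.mackeyCompat_iff.2 ⟨x, y, z, hx, hy, hz, hs, h1, h2⟩)
        refine ⟨i r, ⟨r, hr, rfl⟩, fun x => ?_⟩
        -- The composite and `L (i r)` agree on E, so they agree on V by uniqueness of extensions.
        exact huniq r hr ((L (i p)).comp (L (i q))).toAddMonoidHom (fun a => by
          simp [hL' p hp, hL' q hq, h]) x }
  exact ⟨D, rfl, hL', huniq⟩

end IsUniversalVectorSpace

/-! ### Transfer of comparability and projection covers to V -/

namespace LinearCompressionBase.IsUniqueExtension

variable {B : CompressionBase E} {D : LinearCompressionBase u}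

theorem mem_P_iff (hD : D.IsUniqueExtension i B) (hV : IsUniversalVectorSpace u i) {p : E} :
    i p ∈ D.P ↔ p ∈ B.P := by
  rw [hD.1, hV.injective.mem_set_image]

theorem exists_eq (hD : D.IsUniqueExtension i B) {p : V} (hp : p ∈ D.P) :
    ∃ q ∈ B.P, i q = p := by
  rwa [hD.1] at hp

theorem mem_C_iff (hD : D.IsUniqueExtension i B) (hV : IsUniversalVectorSpace u i) {p a : E}
    (hp : p ∈ B.P) : i a ∈ D.C (i p) ↔ a ∈ B.C p := by
  rw [B.mem_C_iff hV, LinearCompressionBase.mem_C_iff, ← hV.map_orth, hD.2.1 p hp,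
    hD.2.1 _ (B.isSub.orth_mem p hp), eq_comm]

theorem sub_orth_mem_C_iff (hD : D.IsUniqueExtension i B) (hV : IsUniversalVectorSpace u i)
    {p a : E} (hp : p ∈ B.P) : i a - i (orth a) ∈ D.C (i p) ↔ a ∈ B.C p := by
  have hu := unit_mem_C ((hD.mem_P_iff hV).2 hp)
  have e : i a - i (orth a) = i a + i a - u := by rw [hV.map_orth]; abel
  rw [← hD.mem_C_iff hV hp, e]
  constructor
  · intro h
    have := smul_mem_C (2⁻¹ : ℝ) (add_mem_C h hu)
    rwa [sub_add_cancel, ← two_smul ℝ, smul_smul, inv_mul_cancel₀ two_ne_zero, one_smul] at this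
  · exact fun h => sub_mem_C (add_mem_C h h) hu

/-- With `g = r (a - a')`, the projections commuting with `g`, `a` and `a'` are the same, so an
element of `B.PLe (orth a) a` lies in the bicommutant of `g` and splits it by sign. -/
theorem hasGeneralComparability (hD : D.IsUniqueExtension i B) (hV : IsUniversalVectorSpace u i)
    (hB : B.IsSpectral) : D.HasGeneralComparability := by
  intro g
  obtain ⟨r, a, hr, rfl⟩ := hV.exists_sub_orth g
  obtain ⟨p, hp, h1, h2⟩ := hB.1.2 _ _ (hV.commutes_orth B a)
  have hpP := hp.1
  have hpa : a ∈ B.C p := hp.2 a (Or.inr (by simp))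
  have hC : ∀ q ∈ B.P, r • (i a - i (orth a)) ∈ D.C (i q) ↔ a ∈ B.C q := by
    intro q hq
    rw [← hD.sub_orth_mem_C_iff hV hq]
    refine ⟨fun h => ?_, smul_mem_C r⟩
    have := smul_mem_C r⁻¹ h
    rwa [smul_smul, inv_mul_cancel₀ hr.ne', one_smul] at this
  rw [hV.le_iff] at h1 h2
  refine ⟨i p, mem_bicomm_iff.2 ⟨(hD.mem_P_iff hV).2 hpP, (hC p hpP).2 hpa, ?_⟩, ?_, ?_⟩
  · intro q hq hqg
    obtain ⟨q, hqP, rfl⟩ := hD.exists_eq hq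
    rw [hC q hqP] at hqg
    rw [hD.mem_C_iff hV hpP]
    refine hp.2 q (Or.inl ⟨hqP, ?_⟩)
    rintro b (rfl | rfl)
    · exact (hV.orth_mem_C_iff B hqP).2 hqg
    · exact hqg
  · rw [map_smul, map_sub, ← hV.map_orth, hD.2.1 _ (B.isSub.orth_mem p hpP),
      hD.2.1 _ (B.isSub.orth_mem p hpP)]
    exact smul_nonpos_of_nonneg_of_nonpos hr.le (sub_nonpos.2 h2)
  · rw [map_smul, map_sub, hD.2.1 _ hpP, hD.2.1 _ hpP]
    exact smul_nonneg hr.le (sub_nonneg.2 h1)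

/-- The projection cover of `a` is the complement of `a^*`. -/
theorem isProjCover_iff (hD : D.IsUniqueExtension i B) (hV : IsUniversalVectorSpace u i)
    {a p : E} : B.IsProjCover a p ↔ D.IsRickartStar (i a) (u - i p) := by
  have key : ∀ q ∈ B.P, (i a ∈ D.C (u - i q) ∧ D.J (u - i q) (i a) = 0) ↔ a ≤ q := by
    intro q hq
    have hq' := D.compl_mem _ ((hD.mem_P_iff hV).2 hq)
    rw [hV.le_iff, D.apply_eq_zero_iff _ hq' _ (hV.nonneg a) (hV.le_unit a), sub_sub_cancel]
    refine ⟨fun h => h.2, fun h => ⟨?_, h⟩⟩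
    refine mem_C_of_J_eq_zero hV.orderUnit hq' (hV.nonneg a) ?_
    rwa [D.apply_eq_zero_iff _ hq' _ (hV.nonneg a) (hV.le_unit a), sub_sub_cancel]
  have hP : p ∈ B.P ↔ u - i p ∈ D.P := by
    rw [← hD.mem_P_iff hV]
    exact ⟨D.compl_mem _, fun h => by simpa using D.compl_mem _ h⟩
  constructor
  · rintro ⟨hp, h⟩
    refine ⟨hP.1 hp, fun q hq => ?_⟩
    obtain ⟨r, hr, hrq⟩ := hD.exists_eq (D.compl_mem q hq)
    have hqr : q = u - i r := by rw [hrq]; abel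
    rw [hqr, key r hr, h r hr, hV.le_iff, sub_le_sub_iff_left]
  · rintro ⟨hp, h⟩
    refine ⟨hP.2 hp, fun q hq => ?_⟩
    rw [← key q hq, ← h _ (D.compl_mem _ ((hD.mem_P_iff hV).2 hq)), sub_le_sub_iff_left, hV.le_iff]

/-- The absolute value `J q g - J (u - q) g`, scaled into the unit interval, has a projection cover,
and its complement serves as `g^*`: a compression kills the absolute value exactly when it kills `g`
and its projection commutes with `g`. -/
theorem isRickart (hD : D.IsUniqueExtension i B) (hV : IsUniversalVectorSpace u i)
    (hB : B.IsSpectral) : D.IsRickart := by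
  intro g
  obtain ⟨q, hq, hq1, hq2⟩ := hD.hasGeneralComparability hV hB g
  obtain ⟨hqP, hqg, hqc⟩ := mem_bicomm_iff.1 hq
  have hq' := D.compl_mem q hqP
  have habs : 0 ≤ D.J q g - D.J (u - q) g := sub_nonneg.2 (hq1.trans hq2)
  obtain ⟨c, hc, -, hgc⟩ := hV.orderUnit.exists_abs_le (D.J q g - D.J (u - q) g)
  obtain ⟨a, ha⟩ := hV.exists_eq (smul_nonneg (inv_nonneg.2 hc.le) habs)
    ((inv_smul_le_iff_of_pos hc).2 hgc)
  obtain ⟨s, hs⟩ := hB.2 a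
  have hs := (hD.isProjCover_iff hV).1 hs
  refine ⟨u - i s, hs.1, fun p hp => ?_⟩
  have hp' := D.compl_mem p hp
  rw [hs.2 p hp, ha, map_smul, smul_eq_zero_iff_right (inv_ne_zero hc.ne')]
  have h0 := D.positive p hp _ hq2
  have h1 := J_nonpos hp hq1
  constructor
  · rintro ⟨-, h⟩
    rw [map_sub, sub_eq_zero] at h
    -- The two compressed parts are equal, one being positive and the other negative.
    have e1 : D.J p (D.J q g) = 0 := le_antisymm (h ▸ h1) h0
    have e2 : D.J p (D.J (u - q) g) = 0 := h ▸ e1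
    have c1 := mem_C_of_J_eq_zero hV.orderUnit hp hq2 e1
    have c2 := mem_C_of_J_eq_zero hV.orderUnit hp (neg_nonneg.2 hq1) (by rw [map_neg, e2, neg_zero])
    have hg := LinearCompressionBase.mem_C_iff.1 hqg
    constructor
    · have := sub_mem_C c1 c2
      rwa [sub_neg_eq_add, ← hg] at this
    · rw [hg, map_add, e1, e2, add_zero]
  · rintro ⟨hC, h⟩
    have hpq := hqc p hp hC
    have hqp := mem_C_symm hqP hp hpq
    have e1 : D.J p (D.J q g) = 0 := by rw [J_comm hp hqP hqp, h, map_zero]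
    have e2 : D.J p (D.J (u - q) g) = 0 := by
      rw [J_compl_of_mem_C hqg, map_sub, h, e1, sub_zero]
    have e3 : D.J p (D.J q g - D.J (u - q) g) = 0 := by rw [map_sub, e1, e2, sub_zero]
    exact ⟨smul_mem_C _ (mem_C_of_J_eq_zero hV.orderUnit hp habs e3), e3⟩

end LinearCompressionBase.IsUniqueExtension

end Extension

/-! ### Binary and rational spectral resolutions as values of the spectral family -/

theorem natCast_div_two_pow_eq (k n : ℕ) :
    (k : ℝ) / 2 ^ n = ((2 * k : ℕ) : ℝ) / 2 ^ (n + 1) := by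
  rw [pow_succ]; push_cast; field_simp

namespace LinearCompressionBase.IsUniqueExtension

variable {E : Type*} [ConvexEffectAlgebra E]
    {V : Type*} [AddCommGroup V] [PartialOrder V] [IsOrderedAddMonoid V] [Module ℝ V]
    [IsOrderedModule ℝ V] {u : V} {i : E → V}
    {B : CompressionBase E} {D : LinearCompressionBase u}

/-- Every projection in `B.PLe (orth c) c` gives an orthogonal decomposition of `c - c'` in V. These
are unique, so the choice of projection is immaterial. -/
theorem isPosDiff_orth_iff (hD : D.IsUniqueExtension i B) (hV : IsUniversalVectorSpace u i)
    (hB : B.IsSpectral) {c x : E} : B.IsPosDiff c (orth c) x ↔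
      ∃ y, D.IsOrthogonalDecomposition (i c - i (orth c)) (i x) y := by
  have key : ∀ p ∈ B.PLe (orth c) c, ∀ x, i x = D.J (i p) (i c - i (orth c)) →
      ∃ y, D.IsOrthogonalDecomposition (i c - i (orth c)) (i x) y := by
    rintro p ⟨hp, h1, h2⟩ x hx
    rw [hV.le_iff] at h1 h2
    have hdec := IsOrthogonalDecomposition.of_mem (D := D) ((hD.mem_P_iff hV).2 hp.1)
      ((hD.sub_orth_mem_C_iff hV hp.1).2 (hp.2 c (Or.inr (by simp))))
      (by rw [map_sub, hD.2.1 p hp.1, hD.2.1 p hp.1]; exact sub_nonneg.2 h1)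
      (by rw [← hV.map_orth, map_sub, hD.2.1 _ (B.isSub.orth_mem p hp.1),
            hD.2.1 _ (B.isSub.orth_mem p hp.1)]
          exact sub_nonpos.2 h2)
    rw [← hx] at hdec
    exact ⟨_, hdec⟩
  have hsum : ∀ p ∈ B.PLe (orth c) c, ∀ x,
      (perp (B.J p (orth c)) x ∧ oplus (B.J p (orth c)) x = B.J p c) ↔
        i x = D.J (i p) (i c - i (orth c)) := by
    intro p hp x
    rw [hV.oplus_eq_iff, map_sub, hD.2.1 p hp.1.1, hD.2.1 p hp.1.1, eq_sub_iff_add_eq']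
  constructor
  · rintro ⟨-, p, hp, h⟩
    exact key p hp x ((hsum p hp x).1 h)
  · rintro ⟨y, hy⟩
    obtain ⟨p, hp⟩ := hB.1.2 _ _ (hV.commutes_orth B c)
    obtain ⟨z, hz⟩ := hp.2.1
    obtain ⟨w, hw⟩ := key p hp z ((hsum p hp z).1 hz)
    refine ⟨hV.commutes_orth B c, p, hp, (hsum p hp x).2 ?_⟩
    rw [(hy.unique (hD.hasGeneralComparability hV hB) hw).1]
    exact (hsum p hp z).1 hz

/-- For `x` commuting with `v`, the compression `J v x` is below both; and a common lower bound `b`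
satisfies `b = J v b ≤ J v x`. -/
theorem isMeet_iff (hD : D.IsUniqueExtension i B) (hV : IsUniversalVectorSpace u i)
    {x v m : E} (hv : i v ∈ D.P) (hx : i x ∈ D.C (i v)) :
    IsMeet x v m ↔ i m = D.J (i v) (i x) := by
  have hvP := (hD.mem_P_iff hV).1 hv
  have h : IsMeet x v (B.J v x) := by
    constructor
    · rintro b (rfl | rfl)
      · rw [hV.le_iff, ← hD.2.1 v hvP]
        conv_rhs => rw [LinearCompressionBase.mem_C_iff.1 hx]
        exact le_add_of_nonneg_right (D.positive _ (D.compl_mem _ hv) _ (hV.nonneg _))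
      · rw [hV.le_iff]
        exact hV.map_J_le B hvP _
    · intro b hb
      have h1 : b ≤ x := hb (by simp)
      have h2 : b ≤ v := hb (by simp)
      rw [hV.le_iff] at h1 h2 ⊢
      rw [← hD.2.1 v hvP, ← D.apply_of_le _ hv _ (hV.nonneg b) h2]
      exact J_mono hv h1
  rw [hD.2.1 v hvP, hV.injective.eq_iff]
  exact ⟨fun h' => h'.unique h, fun e => e ▸ h⟩

variable {a : E} {e : ℝ → V}

/-- One step of the splitting which defines the binary spectral resolution, in terms of the
spectral resolution in `V`. -/
theorem splitting_step_iff (hD : D.IsUniqueExtension i B) (hV : IsUniversalVectorSpace u i)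
    (hB : B.IsSpectral) (h : D.IsSpectralFamily (i a) e) {k l m t : ℝ} (hkl : k ≤ l) (hlm : l ≤ m)
    (ht : 0 < t) {w : V} (hw : w = t • (i a - l • u)) {c v c₀ c₁ v₀ v₁ : E}
    (hv : i v = e m - e k)
    (hc : i c - i (orth c) = D.J (e m - e k) w - (u - (e m - e k))) :
    (∃ x y r z : E,
      B.IsPosDiff c (orth c) x ∧ B.IsPosDiff (orth c) c y ∧ B.IsProjCover x r ∧
      IsMeet y v z ∧ IsMeet (orth r) v v₀ ∧ IsMeet v (orth v₀) v₁ ∧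
      (perp z c₀ ∧ oplus z c₀ = v₀) ∧ IsMeet x v c₁) ↔
    i v₀ = e l - e k ∧ i v₁ = e m - e l ∧
      i c₀ = (e l - e k) + D.J (e l - e k) w ∧ i c₁ = D.J (e m - e l) w := by
  have hGC := hD.hasGeneralComparability hV hB
  have hR := hD.isRickart hV hB
  have hu := hV.orderUnit
  have hkm := hkl.trans hlm
  have hd := h.sub_mem hlm
  have hd₁ := h.sub_mem hkl
  have hvP := h.sub_mem hkm
  have hdv : e m - e l ≤ e m - e k := sub_le_sub_left (h.mono hkl) _
  have hdv₁ : e l - e k ≤ e m - e k := sub_le_sub_right (h.mono hlm) _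
  have hC : ∀ p ∈ D.P, i a ∈ D.C p → w ∈ D.C p := fun p hp hp' =>
    hw ▸ smul_mem_C t ((sub_smul_unit_mem_C_iff hp l).2 hp')
  have h0 : 0 ≤ D.J (e m - e l) w := by
    rw [hw, map_smul]; exact smul_nonneg ht.le (h.J_sub_nonneg hlm)
  have h1 : D.J (e l - e k) w ≤ 0 := by
    rw [hw, map_smul]; exact smul_nonpos_of_nonneg_of_nonpos ht.le (h.J_sub_nonpos hkl)
  have hdec := h.isOrthogonalDecomposition_step hkl hlm hC h0 h1
  rw [← hc] at hdec
  have hdec' : D.IsOrthogonalDecomposition (i (orth c) - i (orth (orth c)))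
      (u - (e m - e k) - D.J (e l - e k) w) (D.J (e m - e l) w) := by
    rw [orth_orth, ← neg_sub]
    exact hdec.neg
  have hx : ∀ x, B.IsPosDiff c (orth c) x ↔ i x = D.J (e m - e l) w := fun x => by
    rw [hD.isPosDiff_orth_iff hV hB]
    exact ⟨fun ⟨_, h'⟩ => (h'.unique hGC hdec).1, fun h' => ⟨_, h' ▸ hdec⟩⟩
  have hy : ∀ y, B.IsPosDiff (orth c) c y ↔ i y = u - (e m - e k) - D.J (e l - e k) w := fun y => by
    have := hD.isPosDiff_orth_iff hV hB (c := orth c) (x := y)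
    rw [orth_orth] at this
    rw [this]
    rw [orth_orth] at hdec'
    exact ⟨fun ⟨_, h'⟩ => (h'.unique hGC hdec').1, fun h' => ⟨_, h' ▸ hdec'⟩⟩
  have hr : ∀ x r, i x = D.J (e m - e l) w → (B.IsProjCover x r ↔ i r = e m - e l) := by
    intro x r hx
    have := h.isRickartStar_sub hu hR hlm ht
    rw [← hw, ← hx] at this
    rw [hD.isProjCover_iff hV]
    constructor
    · intro h'
      exact sub_right_inj.1 (h'.unique this)
    · intro h'
      rwa [h']
  have hJw : D.J (e m - e k) (D.J (e l - e k) w) = D.J (e l - e k) w := (J_of_le hd₁ hvP hdv₁ w).1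
  have hJw' : D.J (e m - e k) (D.J (e m - e l) w) = D.J (e m - e l) w := (J_of_le hd hvP hdv w).1
  -- The meet with `v` removes the surplus `u - (e m - e k)` from the negative part.
  have hz : ∀ y z, i y = u - (e m - e k) - D.J (e l - e k) w →
      (IsMeet y v z ↔ i z = - D.J (e l - e k) w) := by
    intro y z hy
    rw [hD.isMeet_iff hV (hv ▸ hvP), hv, hy, map_sub, hJw, map_sub, J_self hvP, D.focus _ hvP,
      sub_self, zero_sub]
    rw [hv, hy]
    exact sub_mem_C (sub_mem_C (unit_mem_C hvP) (mem_C_of_le hvP (nonneg_of_mem hvP) le_rfl))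
      (mem_C_J hvP hd₁ (mem_C_of_le hvP (nonneg_of_mem hd₁) hdv₁) (hC _ hvP (h.mem_C_sub hkm)))
  have hv₀ : ∀ r, i r = e m - e l → (IsMeet (orth r) v v₀ ↔ i v₀ = e l - e k) := by
    intro r hr
    rw [hD.isMeet_iff hV (hv ▸ hvP), hv, hV.map_orth, hr, map_sub, D.focus _ hvP,
      D.apply_of_le _ hvP _ (nonneg_of_mem hd) hdv, sub_sub_sub_cancel_left]
    rw [hv, hV.map_orth, hr]
    exact sub_mem_C (unit_mem_C hvP) (mem_C_of_le hvP (nonneg_of_mem hd) hdv)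
  have hv₁ : i v₀ = e l - e k → (IsMeet v (orth v₀) v₁ ↔ i v₁ = e m - e l) := by
    intro hr
    have hd₁' := D.compl_mem _ hd₁
    have hmem : e m - e k ∈ D.C (e l - e k) :=
      mem_C_symm hvP hd₁ (mem_C_of_le hvP (nonneg_of_mem hd₁) hdv₁)
    have hJ := (J_of_le hd₁ hvP hdv₁ u).2
    rw [D.focus _ hvP, D.focus _ hd₁] at hJ
    rw [hD.isMeet_iff hV (by rwa [hV.map_orth, hr]), hV.map_orth, hr, hv,
      J_compl_of_mem_C hmem, hJ, sub_sub_sub_cancel_right]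
    rw [hV.map_orth, hr, hv]
    exact mem_C_compl.2 hmem
  have hc₁ : ∀ x, i x = D.J (e m - e l) w → (IsMeet x v c₁ ↔ i c₁ = D.J (e m - e l) w) := by
    intro x hx
    rw [hD.isMeet_iff hV (hv ▸ hvP), hv, hx, hJw']
    rw [hv, hx]
    exact mem_C_J hvP hd (mem_C_of_le hvP (nonneg_of_mem hd) hdv) (hC _ hvP (h.mem_C_sub hkm))
  have hc₀ : ∀ z, i z = - D.J (e l - e k) w → i v₀ = e l - e k →
      ((perp z c₀ ∧ oplus z c₀ = v₀) ↔ i c₀ = (e l - e k) + D.J (e l - e k) w) := by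
    intro z hz hv₀
    rw [hV.oplus_eq_iff, hz, hv₀, neg_add_eq_iff_eq_add, add_comm]
  constructor
  · rintro ⟨x, y, r, z, g1, g2, g3, g4, g5, g6, g7, g8⟩
    have k1 := (hx x).1 g1
    have k2 := (hv₀ r ((hr x r k1).1 g3)).1 g5
    have k3 := (hz y z ((hy y).1 g2)).1 g4
    exact ⟨k2, (hv₁ k2).1 g6, (hc₀ z k3 k2).1 g7, (hc₁ x k1).1 g8⟩
  · rintro ⟨k1, k2, k3, k4⟩
    have hle : ∀ b : E, i b - i (orth b) ≤ u := fun b =>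
      (sub_le_self _ (hV.nonneg _)).trans (hV.le_unit b)
    obtain ⟨x, hx'⟩ := hV.exists_eq hdec.1 (hdec.le_unit (hle c))
    obtain ⟨r, hr'⟩ := hV.exists_eq (nonneg_of_mem hd) (le_unit_of_mem hd)
    have hyu := hdec'.le_unit (hle (orth c))
    obtain ⟨y, hy'⟩ := hV.exists_eq hdec.2.1 hyu
    obtain ⟨z, hz'⟩ := hV.exists_eq (neg_nonneg.2 h1) (le_trans (by
      rw [sub_eq_add_neg (u - (e m - e k))]
      exact le_add_of_nonneg_left (sub_nonneg.2 (le_unit_of_mem hvP))) hyu)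
    exact ⟨x, y, r, z, (hx x).2 hx', (hy y).2 hy', (hr x r hx').2 hr', (hz y z hy').2 hz',
      (hv₀ r hr').2 k1, (hv₁ k1).2 k2, (hc₀ z hz' k1).2 k3, (hc₁ x hx').2 k4⟩


/-- The slice is cut at its midpoint `(2 k + 1) / 2 ^ (n + 1)`. The hypothesis on `c - c'` holds
because `c - c' = 2 c - u` and `2 (2 ^ n a - k u) - u = 2 ^ (n + 1) a - (2 k + 1) u`. -/
theorem splittingFamily_step_iff (hD : D.IsUniqueExtension i B) (hV : IsUniversalVectorSpace u i)
    (hB : B.IsSpectral) (h : D.IsSpectralFamily (i a) e) {n k : ℕ} {c v c₀ c₁ v₀ v₁ : E}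
    (hv : i v = e ((k + 1 : ℕ) / 2 ^ n) - e (k / 2 ^ n))
    (hc : i c = D.J (e ((k + 1 : ℕ) / 2 ^ n) - e (k / 2 ^ n)) ((2 : ℝ) ^ n • i a - (k : ℝ) • u)) :
    (∃ x y r z : E,
      B.IsPosDiff c (orth c) x ∧ B.IsPosDiff (orth c) c y ∧ B.IsProjCover x r ∧
      IsMeet y v z ∧ IsMeet (orth r) v v₀ ∧ IsMeet v (orth v₀) v₁ ∧
      (perp z c₀ ∧ oplus z c₀ = v₀) ∧ IsMeet x v c₁) ↔
    (i v₀ = e ((2 * k + 1 : ℕ) / 2 ^ (n + 1)) - e ((2 * k : ℕ) / 2 ^ (n + 1)) ∧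
      i c₀ = D.J (e ((2 * k + 1 : ℕ) / 2 ^ (n + 1)) - e ((2 * k : ℕ) / 2 ^ (n + 1)))
        ((2 : ℝ) ^ (n + 1) • i a - ((2 * k : ℕ) : ℝ) • u)) ∧
    (i v₁ = e ((2 * k + 1 + 1 : ℕ) / 2 ^ (n + 1)) - e ((2 * k + 1 : ℕ) / 2 ^ (n + 1)) ∧
      i c₁ = D.J (e ((2 * k + 1 + 1 : ℕ) / 2 ^ (n + 1)) - e ((2 * k + 1 : ℕ) / 2 ^ (n + 1)))
        ((2 : ℝ) ^ (n + 1) • i a - ((2 * k + 1 : ℕ) : ℝ) • u)) := by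
  rw [natCast_div_two_pow_eq k n, natCast_div_two_pow_eq (k + 1) n] at hv hc
  have e1 : 2 * (k + 1) = 2 * k + 1 + 1 := by ring
  rw [e1] at hv hc
  have ht : (0 : ℝ) < 2 ^ (n + 1) := by positivity
  have hmono : ∀ j : ℕ, (j : ℝ) / 2 ^ (n + 1) ≤ ((j + 1 : ℕ) : ℝ) / 2 ^ (n + 1) := fun j => by
    gcongr; simp
  have hw : (2 : ℝ) ^ (n + 1) • i a - ((2 * k + 1 : ℕ) : ℝ) • u =
      (2 : ℝ) ^ (n + 1) • (i a - (((2 * k + 1 : ℕ) : ℝ) / 2 ^ (n + 1)) • u) := by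
    rw [smul_sub, smul_smul, mul_div_cancel₀ _ ht.ne']
  have hw₀ : (2 : ℝ) ^ (n + 1) • i a - ((2 * k : ℕ) : ℝ) • u =
      ((2 : ℝ) ^ (n + 1) • i a - ((2 * k + 1 : ℕ) : ℝ) • u) + u := by
    push_cast; module
  have hvP := h.sub_mem ((hmono (2 * k)).trans (hmono (2 * k + 1)))
  have hv₀P := h.sub_mem (hmono (2 * k))
  rw [hD.splitting_step_iff hV hB h (hmono (2 * k)) (hmono (2 * k + 1)) ht hw hv]
  · rw [hw₀, map_add, D.focus _ hv₀P, add_comm (D.J _ _)]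
    tauto
  · have e2 : (2 : ℝ) ^ (n + 1) • i a - ((2 * k + 1 : ℕ) : ℝ) • u =
        (2 : ℝ) • ((2 : ℝ) ^ n • i a - (k : ℝ) • u) - u := by
      push_cast; module
    rw [hV.map_orth, e2, map_sub, map_smul, ← hc, D.focus _ hvP]
    module

theorem isSplittingFamily_iff (hD : D.IsUniqueExtension i B) (hV : IsUniversalVectorSpace u i)
    (hB : B.IsSpectral) (h : D.IsSpectralFamily (i a) e) {c v : ℕ → ℕ → E} :
    B.IsSplittingFamily a c v ↔ ∀ n k : ℕ, k < 2 ^ n →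
      i (v n k) = e ((k + 1 : ℕ) / 2 ^ n) - e (k / 2 ^ n) ∧
      i (c n k) = D.J (e ((k + 1 : ℕ) / 2 ^ n) - e (k / 2 ^ n))
        ((2 : ℝ) ^ n • i a - (k : ℝ) • u) := by
  have hu := hV.orderUnit
  have he1 : e 1 = u := h.eq_unit hu (hV.le_unit a) le_rfl
  have h00 : B.IsProjCover a (v 0 0) ↔ i (v 0 0) = u - e 0 := by
    have hs := h.star 0
    rw [zero_smul, sub_zero, h.J_compl_zero (hV.nonneg a)] at hs
    rw [hD.isProjCover_iff hV]
    constructor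
    · intro h'
      rw [← h'.unique hs, sub_sub_cancel]
    · intro h'
      rwa [h', sub_sub_cancel]
  constructor
  · intro hf n
    induction n with
    | zero =>
      intro k hk
      obtain rfl : k = 0 := by simpa using hk
      have := h00.1 hf.u_zero
      simp [this, he1, hf.c_zero, h.J_compl_zero (hV.nonneg a)]
    | succ n ih =>
      intro k hk
      have hk' : k / 2 < 2 ^ n := by rw [pow_succ] at hk; omega
      obtain ⟨h1, h2⟩ := ih (k / 2) hk'
      have := (hD.splittingFamily_step_iff hV hB h h1 h2).1 (hf.step n _ hk')
      rcases Nat.mod_two_eq_zero_or_one k with hm | hm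
      · have e1 : 2 * (k / 2) = k := by omega
        rw [e1] at this
        exact this.1
      · have e1 : 2 * (k / 2) + 1 = k := by omega
        rw [e1] at this
        exact this.2
  · intro hf
    have h1 := hf 0 0 (by simp)
    simp only [Nat.zero_add, Nat.cast_one, pow_zero, div_one, Nat.cast_zero, he1, one_smul,
      zero_smul, sub_zero, h.J_compl_zero (hV.nonneg a)] at h1
    refine ⟨hV.injective h1.2, h00.2 h1.1, fun n k hk => ?_⟩
    obtain ⟨h1, h2⟩ := hf n k hk
    refine (hD.splittingFamily_step_iff hV hB h h1 h2).2 ⟨hf _ _ ?_, hf _ _ ?_⟩ <;>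
      rw [pow_succ] <;> omega

theorem exists_isSplittingFamily (hD : D.IsUniqueExtension i B) (hV : IsUniversalVectorSpace u i)
    (hB : B.IsSpectral) (h : D.IsSpectralFamily (i a) e) :
    ∃ c v : ℕ → ℕ → E, B.IsSplittingFamily a c v := by
  have hmono : ∀ n k : ℕ, (k : ℝ) / 2 ^ n ≤ ((k + 1 : ℕ) : ℝ) / 2 ^ n := fun n k => by
    gcongr; simp
  have hv : ∀ n k : ℕ, ∃ b, i b = e ((k + 1 : ℕ) / 2 ^ n) - e (k / 2 ^ n) := fun n k =>
    hV.exists_eq (nonneg_of_mem (h.sub_mem (hmono n k))) (le_unit_of_mem (h.sub_mem (hmono n k)))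
  have hc : ∀ n k : ℕ, ∃ b, i b = D.J (e ((k + 1 : ℕ) / 2 ^ n) - e (k / 2 ^ n))
      ((2 : ℝ) ^ n • i a - (k : ℝ) • u) := by
    intro n k
    have ht : (0 : ℝ) < 2 ^ n := by positivity
    have hw : ∀ j : ℝ, (2 : ℝ) ^ n • i a - j • u = (2 : ℝ) ^ n • (i a - (j / 2 ^ n) • u) := by
      intro j
      rw [smul_sub, smul_smul, mul_div_cancel₀ _ ht.ne']
    have hP := h.sub_mem (hmono n k)
    refine hV.exists_eq ?_ ?_
    · rw [hw, map_smul]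
      exact smul_nonneg ht.le (h.J_sub_nonneg (hmono n k))
    · have e1 : (2 : ℝ) ^ n • i a - (k : ℝ) • u =
          ((2 : ℝ) ^ n • i a - ((k + 1 : ℕ) : ℝ) • u) + u := by
        push_cast; module
      rw [e1, map_add, D.focus _ hP, hw, map_smul]
      refine (add_le_of_nonpos_left ?_).trans (le_unit_of_mem hP)
      exact smul_nonpos_of_nonneg_of_nonpos ht.le (h.J_sub_nonpos (hmono n k))
  choose v hv using hv
  choose c hc using hc
  exact ⟨c, v, (hD.isSplittingFamily_iff hV hB h).2 fun n k _ => ⟨hv n k, hc n k⟩⟩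

/-- The partial sums start at `e 0` and telescope. The definition fixes only 0, 1 and odd
numerators; an even numerator cancels to a lower level. -/
theorem isBinarySpectralResolution_iff (hD : D.IsUniqueExtension i B)
    (hV : IsUniversalVectorSpace u i) (hB : B.IsSpectral) (h : D.IsSpectralFamily (i a) e)
    {b : ℚ → E} : B.IsBinarySpectralResolution a b ↔
      ∀ n k : ℕ, k ≤ 2 ^ n → i (b ((k : ℚ) / 2 ^ n)) = e ((k : ℝ) / 2 ^ n) := by
  have he1 : e 1 = u := h.eq_unit hV.orderUnit (hV.le_unit a) le_rfl
  have hsum : ∀ c v : ℕ → ℕ → E, B.IsSplittingFamily a c v → i (orth (v 0 0)) = e 0 ∧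
      ∀ n k : ℕ, k < 2 ^ n → ∀ s, OSumsTo (orth (v 0 0)) (v (n + 1)) (2 * k + 1) s ↔
        i s = e (((2 * k + 1 : ℕ) : ℝ) / 2 ^ (n + 1)) := by
    intro c v hf
    rw [hD.isSplittingFamily_iff hV hB h] at hf
    have h0 : i (orth (v 0 0)) = e 0 := by
      have := (hf 0 0 (by simp)).1
      rw [hV.map_orth, this]
      simp [he1]
    refine ⟨h0, fun n k hk s => ?_⟩
    have h1 : ∑ j ∈ Finset.range (2 * k + 1), i (v (n + 1) j) =
        e (((2 * k + 1 : ℕ) : ℝ) / 2 ^ (n + 1)) - e (((0 : ℕ) : ℝ) / 2 ^ (n + 1)) := by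
      rw [← Finset.sum_range_sub (fun j : ℕ => e ((j : ℝ) / 2 ^ (n + 1)))]
      refine Finset.sum_congr rfl fun j hj => (hf _ _ ?_).1
      rw [Finset.mem_range] at hj
      rw [pow_succ]; omega
    rw [hV.oSumsTo_iff, h0, h1]
    simp
  constructor
  · rintro ⟨c, v, hf, hb0, hb1, hb⟩
    obtain ⟨h0, hs⟩ := hsum c v hf
    intro n
    induction n with
    | zero =>
      intro k hk
      have : k = 0 ∨ k = 1 := by rw [pow_zero] at hk; omega
      rcases this with rfl | rfl
      · simp [hb0, h0]
      · simp [hb1, he1, hV.map_one]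
    | succ n ih =>
      intro k hk
      rcases Nat.mod_two_eq_zero_or_one k with hm | hm
      · obtain ⟨j, rfl⟩ : ∃ j, k = 2 * j := ⟨k / 2, by omega⟩
        have hq : (((2 * j : ℕ) : ℚ) / 2 ^ (n + 1)) = (j : ℚ) / 2 ^ n := by
          rw [pow_succ]; push_cast; field_simp
        rw [hq, ← natCast_div_two_pow_eq]
        exact ih j (by rw [pow_succ] at hk; omega)
      · obtain ⟨j, rfl⟩ : ∃ j, k = 2 * j + 1 := ⟨k / 2, by omega⟩
        have hj : j < 2 ^ n := by rw [pow_succ] at hk; omega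
        exact (hs n j hj _).1 (hb n j hj)
  · intro hb
    obtain ⟨c, v, hf⟩ := hD.exists_isSplittingFamily hV hB h
    obtain ⟨h0, hs⟩ := hsum c v hf
    refine ⟨c, v, hf, hV.injective ?_, hV.injective ?_, fun n k hk => (hs n k hk _).2 ?_⟩
    · rw [h0]
      simpa using hb 0 0 (by simp)
    · rw [hV.map_one, ← he1]
      simpa using hb 0 1 (by simp)
    · exact hb _ _ (by rw [pow_succ]; omega)

/-- The infimum is taken in all of E, not only among projections; this is why right continuity is
proved against arbitrary positive lower bounds. -/
theorem isGLB_iff (hD : D.IsUniqueExtension i B) (hV : IsUniversalVectorSpace u i)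
    (hu : IsOrderUnitSpace u) (hB : B.IsSpectral) (h : D.IsSpectralFamily (i a) e) {l : ℝ}
    {S : Set ℝ} (hS : ∀ m ∈ S, l ≤ m) (hS' : ∀ ε > 0, ∃ m ∈ S, m ≤ l + ε) (y : E) :
    IsGLB {x | ∃ m ∈ S, i x = e m} y ↔ i y = e l := by
  have key : ∀ z, i z = e l → IsGLB {x | ∃ m ∈ S, i x = e m} z := by
    intro z hz
    constructor
    · rintro x ⟨m, hm, hx⟩
      rw [hV.le_iff, hz, hx]
      exact h.mono (hS m hm)
    · intro x hx
      rw [hV.le_iff, hz]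
      refine h.le_of_forall_pos hu (hD.isRickart hV hB) (hV.nonneg x) fun ε hε => ?_
      obtain ⟨m, hm, hmε⟩ := hS' ε hε
      obtain ⟨w, hw⟩ := hV.exists_eq (nonneg_of_mem (h.mem m)) (le_unit_of_mem (h.mem m))
      exact ⟨m, hS m hm, hmε, hw ▸ hV.le_iff.1 (hx ⟨m, hm, hw⟩)⟩
  refine ⟨fun hy => ?_, key y⟩
  obtain ⟨w, hw⟩ := hV.exists_eq (nonneg_of_mem (h.mem l)) (le_unit_of_mem (h.mem l))
  rw [hy.unique (key w hw), hw]

theorem isRationalSpectralResolution_iff (hD : D.IsUniqueExtension i B)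
    (hV : IsUniversalVectorSpace u i) (hu : IsOrderUnitSpace u) (hB : B.IsSpectral)
    (h : D.IsSpectralFamily (i a) e) {p : ℚ → E} :
    B.IsRationalSpectralResolution a p ↔ ∀ m : ℚ, i (p m) = e m := by
  have hneg : ∀ l : ℚ, l < 0 → (p l = 0 ↔ i (p l) = e l) := fun l hl => by
    rw [h.eq_zero (hV.nonneg a) (by exact_mod_cast hl), ← hV.map_zero, hV.injective.eq_iff]
  have hone : ∀ l : ℚ, 1 ≤ l → (p l = 1 ↔ i (p l) = e l) := fun l hl => by
    rw [h.eq_unit hV.orderUnit (hV.le_unit a) (by exact_mod_cast hl), ← hV.map_one,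
      hV.injective.eq_iff]
  have hmid : ∀ b, B.IsBinarySpectralResolution a b → ∀ l : ℚ, 0 ≤ l → l < 1 →
      (IsGLB {x | ∃ m : ℚ, l < m ∧ m ≤ 1 ∧ (∃ k n : ℕ, m = (k : ℚ) / 2 ^ n) ∧ x = b m} (p l) ↔
        i (p l) = e l) := by
    intro b hb l hl0 hl1
    rw [hD.isBinarySpectralResolution_iff hV hB h] at hb
    rw [← hD.isGLB_iff hV hu hB h (l := (l : ℝ))
      (S := {r | ∃ m : ℚ, l < m ∧ m ≤ 1 ∧ (∃ k n : ℕ, m = (k : ℚ) / 2 ^ n) ∧ r = m})]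
    · have hval : ∀ m : ℚ, m ≤ 1 → (∃ k n : ℕ, m = (k : ℚ) / 2 ^ n) → i (b m) = e m := by
        rintro _ hm ⟨k, n, rfl⟩
        have hk : k ≤ 2 ^ n := by
          rw [div_le_one (by positivity)] at hm
          exact_mod_cast hm
        rw [hb n k hk]
        push_cast; rfl
      have hset : {x | ∃ m : ℚ, l < m ∧ m ≤ 1 ∧ (∃ k n : ℕ, m = (k : ℚ) / 2 ^ n) ∧ x = b m} =
          {x | ∃ r ∈ {r : ℝ | ∃ m : ℚ, l < m ∧ m ≤ 1 ∧ (∃ k n : ℕ, m = (k : ℚ) / 2 ^ n) ∧ r = m},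
            i x = e r} := by
        ext x
        constructor
        · rintro ⟨m, h1, h2, h3, rfl⟩
          exact ⟨m, ⟨m, h1, h2, h3, rfl⟩, hval m h2 h3⟩
        · rintro ⟨_, ⟨m, h1, h2, h3, rfl⟩, hx⟩
          exact ⟨m, h1, h2, h3, hV.injective (by rw [hx, hval m h2 h3])⟩
      rw [hset]
    · rintro _ ⟨m, h1, -, -, rfl⟩
      exact_mod_cast h1.le
    · intro ε hε
      obtain ⟨δ, hδ0, hδε⟩ := exists_rat_btwn hε
      have hδ0 : 0 < δ := by exact_mod_cast hδ0
      -- The dyadic `(⌊l 2^n⌋ + 1) / 2^n` is strictly above `l` and exceeds it by at most `2^(-n)`;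
      -- taking this below `1 - l` as well keeps it at most 1.
      obtain ⟨n, hn⟩ := exists_pow_lt_of_lt_one (lt_min hδ0 (sub_pos.2 hl1))
        (by norm_num : (2⁻¹ : ℚ) < 1)
      rw [inv_pow, lt_min_iff] at hn
      have h2 : (0 : ℚ) < 2 ^ n := by positivity
      have hf := Nat.lt_floor_add_one (l * 2 ^ n)
      have hf' := Nat.floor_le (by positivity : 0 ≤ l * 2 ^ n)
      have hle : ((⌊l * 2 ^ n⌋₊ + 1 : ℕ) : ℚ) / 2 ^ n ≤ l + (2 ^ n)⁻¹ := by
        rw [div_le_iff₀ h2, add_mul, inv_mul_cancel₀ h2.ne']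
        push_cast; linarith
      refine ⟨_, ⟨((⌊l * 2 ^ n⌋₊ + 1 : ℕ) : ℚ) / 2 ^ n, ?_, ?_, ⟨_, n, rfl⟩, rfl⟩, ?_⟩
      · rw [lt_div_iff₀ h2]; exact_mod_cast hf
      · linarith
      · have h3 : ((⌊l * 2 ^ n⌋₊ + 1 : ℕ) : ℚ) / 2 ^ n ≤ l + δ := by linarith
        have h4 : ((((⌊l * 2 ^ n⌋₊ + 1 : ℕ) : ℚ) / 2 ^ n : ℚ) : ℝ) ≤ ((l + δ : ℚ) : ℝ) :=
          Rat.cast_le.2 h3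
        refine h4.trans ?_
        push_cast; linarith
  constructor
  · rintro ⟨b, hb, h1, h2, h3⟩ l
    rcases lt_or_ge l 0 with hl | hl
    · exact (hneg l hl).1 (h1 l hl)
    · rcases lt_or_ge l 1 with hl1 | hl1
      · exact (hmid b hb l hl hl1).1 (h2 l hl hl1)
      · exact (hone l hl1).1 (h3 l hl1)
  · intro hp
    -- Only dyadic values in `[0, 1]` matter for a binary resolution, so `p` itself can serve as
    -- one.
    have hb : B.IsBinarySpectralResolution a p :=
      (hD.isBinarySpectralResolution_iff hV hB h).2 fun n k _ => by
        rw [hp]; push_cast; rfl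
    exact ⟨p, hb, fun l hl => (hneg l hl).2 (hp l), fun l h0 h1 => (hmid p hb l h0 h1).2 (hp l),
      fun l hl => (hone l hl).2 (hp l)⟩

end LinearCompressionBase.IsUniqueExtension

/-! ### The main theorem -/

theorem mainTheorem8 {E : Type*} [ConvexEffectAlgebra E]
    {V : Type*} [AddCommGroup V] [PartialOrder V] [IsOrderedAddMonoid V] [Module ℝ V]
    [IsOrderedModule ℝ V] (u : V) (i : E → V) (hV : IsUniversalVectorSpace u i)
    (hE : IsArchimedean E) (B : CompressionBase E) (hB : B.IsSpectral) :
    IsStronglyArchimedean E ∧ IsOrderUnitSpace u ∧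
    ∃ D : LinearCompressionBase u, D.IsUniqueExtension i B ∧ D.IsSpectralOrderUnitSpace ∧
      ∀ a : E,
        (∃! p : ℚ → E, B.IsRationalSpectralResolution a p) ∧
        ∀ p : ℚ → E, B.IsRationalSpectralResolution a p →
          ∃ pr : ℝ → E,
            (∀ l : ℝ, IsGLB {x | ∃ m : ℚ, l < (m : ℝ) ∧ x = p m} (pr l)) ∧
            (∀ m : ℚ, pr (m : ℝ) = p m) ∧
            (∀ l : ℝ, pr l ∈ B.P) ∧
            (∀ (l : ℝ) (q : V), D.IsSpectralProjection (i a) l q ↔ q = i (pr l)) ∧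
            HasRiemannStieltjesIntegral u (fun l => l) (fun l => i (pr l)) 0 1 (i a) := by
  have hu := hV.isOrderUnitSpace hE B hB
  obtain ⟨D, hD⟩ := hV.exists_linearCompressionBase hu B
  have hGC := hD.hasGeneralComparability hV hB
  have hR := hD.isRickart hV hB
  refine ⟨hV.isStronglyArchimedean hu, hu, D, hD, ⟨hu, hGC, hR⟩, fun a => ?_⟩
  obtain ⟨e, he⟩ := LinearCompressionBase.exists_isSpectralFamily hu.1 hGC hR (i a)
  choose pr hpr hi using fun l => hD.exists_eq (he.mem l)
  have hiff := fun p => hD.isRationalSpectralResolution_iff hV hu hB he (p := p)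
  refine ⟨⟨fun m => pr m, (hiff _).2 fun m => hi m, fun p hp => funext fun m => ?_⟩,
    fun p hp => ⟨pr, fun l => ?_, fun m => ?_, hpr, fun l q => ?_, ?_⟩⟩
  · exact hV.injective (by rw [(hiff p).1 hp, hi])
  · have hset : {x | ∃ m : ℚ, l < (m : ℝ) ∧ x = p m} =
        {x | ∃ r ∈ {r : ℝ | ∃ m : ℚ, l < (m : ℝ) ∧ r = m}, i x = e r} := by
      ext x
      constructor
      · rintro ⟨m, hm, rfl⟩
        exact ⟨m, ⟨m, hm, rfl⟩, (hiff p).1 hp m⟩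
      · rintro ⟨_, ⟨m, hm, rfl⟩, hx⟩
        exact ⟨m, hm, hV.injective (by rw [hx, (hiff p).1 hp])⟩
    rw [hset, hD.isGLB_iff hV hu hB he]
    · exact hi l
    · rintro _ ⟨m, hm, rfl⟩
      exact hm.le
    · intro ε hε
      obtain ⟨m, h1, h2⟩ := exists_rat_btwn (lt_add_of_pos_right l hε)
      exact ⟨m, ⟨m, h1, rfl⟩, h2.le⟩
  · exact hV.injective (by rw [hi, (hiff p).1 hp])
  · rw [he.isSpectralProjection_iff hGC, hi]
  · simp only [hi]
    exact he.hasRiemannStieltjesIntegral hu.1 (hV.nonneg a) (hV.le_unit a)
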